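/- Let $U\subset\mathbb C^m$ be open and let $\star$ be a star product with separation of variables (of the anti-Wick type) on $U$: an associative product $f\star g=\sum_{r\ge 0}\nu^r C_r(f,g)$ with unit $1$ on $C^\infty(U)[\nu^{-1},\nu]]$ (Laurent series in $\nu$), where the $C_r$ are bidifferential operators and $C_0(f,g)=fg$, such that $a\star f=af$ and $f\star b=fb$ for all locally defined holomorphic $a$ and antiholomorphic $b$. Assume that $\star$ is nondegenerate, i.e. the Poisson bracket $\{f,g\}=-i(C_1(f,g)-C_1(g,f))$ is nondegenerate. Let $(g_{kl})$ be the inverse of the Poisson tensor $g^{lk}$, where $C_1(f,g)=g^{lk}\,\frac{\partial f}{\partial\bar z^l}\frac{\partial g}{\partial z^k}$, and put $\omega_{-1}=i\,g_{kl}\,dz^k\wedge d\bar z^l$. A formal function has compact support if each of its coefficients has. Let $\mu_\star=t\,dz\,d\bar z$ be the canonical trace density of $\star$, where $dz\,d\bar z$ is Lebesgue measure and $t\in C^\infty(U)[\nu^{-1},\nu]]$. That is, $\int f\star g\,\mu_\star=\int g\star f\,\mu_\star$ whenever $f$ or $g$ has compact support; $\mu_\star=\frac{1}{m!\,\nu^m}\omega_{-1}^m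 e^{\varkappa}$ with $\varkappa=\nu\varkappa_1+\nu^2\varkappa_2+\dots$; and for every contractible open $V\subset U$ one has $\frac{d}{d\nu}\int_V f\mu_\star=\int_V\delta(f)\mu_\star$ for all $f$ with compact support in $V$ and all derivations of $\star$ on $V$ of the form $\delta=\frac{d}{d\nu}+A$, where $A=\nu^{-1}A_{-1}+A_0+\dots$ is a formal differential operator. Let $\theta^1,\dots,\theta^d,\bar\theta^1,\dots,\bar\theta^d$ be odd variables, $\theta^I=\theta^{\alpha_1}\cdots\theta^{\alpha_k}$ for $I=\{\alpha_1<\dots<\alpha_k\}\subset[d]=\{1,\dots,d\}$, and write formal functions on $U\times\mathbb C^{0|d}$ as $f=\sum f_{IJ}\theta^I\bar\theta^J$ with $f_{IJ}\in C^\infty(U)[\nu^{-1},\nu]]$. Let $u=\sum u_{PQ}\theta^P\bar\theta^Q$ be admissible: $u$ is even, $u_{\emptyset\emptyset}=1$, and the matrix $(u_{PQ})$ has a two-sided inverse $(v^{QP})$ over the algebra $(C^\infty(U)[\nu^{-1},\nu]],\star)$. Then the map $(f_K^I)\mapsto u^{-1}\sum_{I,K,L}(f_K^I\star u_{IL})\theta^K\bar\theta^L$,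 from $2^d\times 2^d$ matrices over $(C^\infty(U)[\nu^{-1},\nu]],\star)$ to formal functions on $U\times\mathbb C^{0|d}$, is a bijection. Let $\ast$ be the product transferred from the matrix algebra through it (the product associated with $(\star,u)$), and for $f$ with compact support that corresponds to the matrix $(f_K^I)$ let $$\sigma(f)=\mathrm{Str}(f_K^I)=\sum_I(-1)^{|I|}\int_U f_I^I\,\mu_\star .$$ There is a unique formal function $\rho$ on $U\times\mathbb C^{0|d}$ such that, with $\mu=\rho\,dz\,d\bar z\,d\theta\,d\bar\theta$, one has $\sigma(f)=\int f\,\mu$ for all $f$ with compact support, where $\int f_{IJ}\theta^I\bar\theta^J\,d\theta\,d\bar\theta=f_{[d][d]}$. This $\mu$ is a supertrace density: $\int (f\ast g)\,\mu=(-1)^{|f||g|}\int (g\ast f)\,\mu$ for homogeneous $f,g$, one of which has compact support. Moreover there is a unique formal differential operator $I_\star=1+\nu I_1+\nu^2I_2+\dots$ on $U$ with $I_\star(ba)=b\star a$ for all locally defined holomorphic $a$ and antiholomorphic $b$; it is invertible on $C^\infty(U)[\nu^{-1},\nu]]$, and $$\rho=u\,\tau\,t,\qquad \tau=\sum_{K,Q}\tau_{KQ}\theta^K\bar\theta^Q,\qquad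 \tau_{KQ}=(-1)^{|K'|+\lambda(K',Q')}\,I_\star^{-1}\bigl(v^{Q'K'}\bigr),$$ where $K'=[d]\setminus K$, $\lambda(K,Q)=|K'||Q|+\varepsilon(K)+\varepsilon(Q)$ and $\varepsilon(\{\alpha_1,\dots,\alpha_k\})=\alpha_1+\dots+\alpha_k-\frac{k(k+1)}{2}$. -/

import Mathlib

open scoped BigOperators ContDiff

namespace SuperBerezin

/-! ### The Grassmann algebra in the odd variables `θ¹, …, θᵈ, θ̄¹, …, θ̄ᵈ` -/

section Grassmann

/-- The Grassmann algebra over `R` in the odd generators `θ^1, …, θ^d, θ̄^1, …, θ̄^d`.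
An element `f` is given by its coefficients: `f = ∑_{I, J} f I J θ^I θ̄^J`, where
`θ^I = θ^{α₁} ⋯ θ^{α_k}` for `I = {α₁ < ⋯ < α_k}`. -/
def Grass (d : ℕ) (R : Type*) : Type _ := Finset (Fin d) → Finset (Fin d) → R

variable {d : ℕ} {R : Type*}

/-- The number of inversions in the juxtaposition of two ordered subsets, so that
`θ^I θ^J = (-1)^(inversions I J) θ^(I ∪ J)` when `I` and `J` are disjoint. -/
def inversions (I J : Finset (Fin d)) : ℕ := ((I ×ˢ J).filter (fun p => p.2 < p.1)).card

/-- The exponent `s` in `θ^I θ̄^J · θ^I' θ̄^J' = (-1)^s θ^(I ∪ I') θ̄^(J ∪ J')`. -/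
def sgnExp (I J I' J' : Finset (Fin d)) : ℕ := J.card * I'.card + inversions I I' + inversions J J'

instance [AddCommGroup R] : AddCommGroup (Grass d R) :=
  inferInstanceAs (AddCommGroup (Finset (Fin d) → Finset (Fin d) → R))

instance [CommRing R] : Mul (Grass d R) where
  mul f g := fun K L => ∑ I ∈ K.powerset, ∑ J ∈ L.powerset,
    (-1) ^ sgnExp I J (K \ I) (L \ J) * f I J * g (K \ I) (L \ J)

instance [CommRing R] : One (Grass d R) where
  one := fun K L => if K = ∅ ∧ L = ∅ then 1 else 0

theorem Grass.mul_apply [CommRing R] (f g : Grass d R) (K L : Finset (Fin d)) :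
    (f * g) K L = ∑ I ∈ K.powerset, ∑ J ∈ L.powerset,
      (-1) ^ sgnExp I J (K \ I) (L \ J) * f I J * g (K \ I) (L \ J) := rfl

theorem Grass.one_apply [CommRing R] (K L : Finset (Fin d)) :
    (1 : Grass d R) K L = if K = ∅ ∧ L = ∅ then 1 else 0 := rfl

theorem Grass.add_apply [AddCommGroup R] (f g : Grass d R) (K L : Finset (Fin d)) :
    (f + g) K L = f K L + g K L := rfl

theorem Grass.zero_apply [AddCommGroup R] (K L : Finset (Fin d)) :
    (0 : Grass d R) K L = 0 := rfl

theorem inversions_union_left {A C : Finset (Fin d)} (E : Finset (Fin d)) (h : Disjoint A C) :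
    inversions (A ∪ C) E = inversions A E + inversions C E := by
  unfold inversions
  rw [Finset.union_product, Finset.filter_union, Finset.card_union_of_disjoint]
  exact Finset.disjoint_filter_filter (Finset.disjoint_product.2 (Or.inl h))

theorem inversions_union_right (A : Finset (Fin d)) {C E : Finset (Fin d)} (h : Disjoint C E) :
    inversions A (C ∪ E) = inversions A C + inversions A E := by
  unfold inversions
  rw [Finset.product_union, Finset.filter_union, Finset.card_union_of_disjoint]
  exact Finset.disjoint_filter_filter (Finset.disjoint_product.2 (Or.inr h))

theorem sum_chain {α M : Type*} [DecidableEq α] [AddCommMonoid M] (K : Finset α)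
    (F : Finset α → Finset α → Finset α → M) :
    ∑ I ∈ K.powerset, ∑ A ∈ I.powerset, F A (I \ A) (K \ I) =
      ∑ A ∈ K.powerset, ∑ C ∈ (K \ A).powerset, F A C ((K \ A) \ C) := by
  rw [Finset.sum_sigma', Finset.sum_sigma']
  refine Finset.sum_nbij' (fun p => ⟨p.2, p.1 \ p.2⟩) (fun p => ⟨p.1 ∪ p.2, p.1⟩) ?_ ?_ ?_ ?_ ?_
  · rintro ⟨I, A⟩ h
    simp only [Finset.mem_sigma, Finset.mem_powerset] at h ⊢
    exact ⟨h.2.trans h.1, Finset.sdiff_subset_sdiff h.1 le_rfl⟩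
  · rintro ⟨A, C⟩ h
    simp only [Finset.mem_sigma, Finset.mem_powerset] at h ⊢
    exact ⟨Finset.union_subset h.1 (h.2.trans Finset.sdiff_subset), Finset.subset_union_left⟩
  · rintro ⟨I, A⟩ h
    simp only [Finset.mem_sigma, Finset.mem_powerset] at h
    simp [Finset.union_sdiff_of_subset h.2]
  · rintro ⟨A, C⟩ h
    simp only [Finset.mem_sigma, Finset.mem_powerset] at h
    have hd : Disjoint A C := (Finset.disjoint_sdiff).mono_right h.2
    simp [Finset.union_sdiff_cancel_left hd]
  · rintro ⟨I, A⟩ h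
    simp only [Finset.mem_sigma, Finset.mem_powerset] at h
    have : (K \ A) \ (I \ A) = K \ I := by
      ext x
      have := @h.2 x
      simp only [Finset.mem_sdiff]
      tauto
    simp [this]

theorem Grass.mul_assoc' [CommRing R] (f g h : Grass d R) : f * g * h = f * (g * h) := by
  funext K L
  let G : Finset (Fin d) → Finset (Fin d) → Finset (Fin d) → Finset (Fin d) → Finset (Fin d) →
      Finset (Fin d) → R := fun A C E B D E' =>
    (-1) ^ (sgnExp A B C D + (B ∪ D).card * E.card + inversions (A ∪ C) E + inversions (B ∪ D) E') *
      f A B * g C D * h E E'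
  have hL : (f * g * h) K L = ∑ I ∈ K.powerset, ∑ A ∈ I.powerset,
      ∑ J ∈ L.powerset, ∑ B ∈ J.powerset, G A (I \ A) (K \ I) B (J \ B) (L \ J) := by
    simp only [Grass.mul_apply]
    refine Finset.sum_congr rfl fun I _ => ?_
    rw [Finset.sum_comm]
    refine Finset.sum_congr rfl fun J _ => ?_
    rw [Finset.mul_sum, Finset.sum_mul]
    refine Finset.sum_congr rfl fun A hA => ?_
    rw [Finset.mul_sum, Finset.sum_mul]
    refine Finset.sum_congr rfl fun B hB => ?_
    rw [Finset.mem_powerset] at hA hB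
    simp only [G, sgnExp, Finset.union_sdiff_of_subset hA, Finset.union_sdiff_of_subset hB]
    ring
  have hR : (f * (g * h)) K L = ∑ A ∈ K.powerset, ∑ C ∈ (K \ A).powerset,
      ∑ B ∈ L.powerset, ∑ D ∈ (L \ B).powerset, G A C ((K \ A) \ C) B D ((L \ B) \ D) := by
    simp only [Grass.mul_apply]
    refine Finset.sum_congr rfl fun A _ => ?_
    rw [Finset.sum_comm]
    refine Finset.sum_congr rfl fun B _ => ?_
    rw [Finset.mul_sum]
    refine Finset.sum_congr rfl fun C hC => ?_
    rw [Finset.mul_sum]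
    refine Finset.sum_congr rfl fun D hD => ?_
    rw [Finset.mem_powerset] at hC hD
    have hAC : Disjoint A C := Finset.disjoint_sdiff.mono_right hC
    have hBD : Disjoint B D := Finset.disjoint_sdiff.mono_right hD
    have hCE : Disjoint C ((K \ A) \ C) := Finset.disjoint_sdiff
    have hDE : Disjoint D ((L \ B) \ D) := Finset.disjoint_sdiff
    have e1 : inversions A (K \ A) = inversions A C + inversions A ((K \ A) \ C) := by
      rw [← inversions_union_right A hCE, Finset.union_sdiff_of_subset hC]
    have e2 : inversions B (L \ B) = inversions B D + inversions B ((L \ B) \ D) := by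
      rw [← inversions_union_right B hDE, Finset.union_sdiff_of_subset hD]
    have e3 : (K \ A).card = C.card + ((K \ A) \ C).card := by
      rw [← Finset.card_union_of_disjoint hCE, Finset.union_sdiff_of_subset hC]
    simp only [G, sgnExp, inversions_union_left _ hAC, inversions_union_left _ hBD, e1, e2, e3,
      Finset.card_union_of_disjoint hBD]
    ring
  rw [hL, hR, ← sum_chain K (fun A C E => ∑ B ∈ L.powerset, ∑ D ∈ (L \ B).powerset,
    G A C E B D ((L \ B) \ D))]
  refine Finset.sum_congr rfl fun I _ => Finset.sum_congr rfl fun A _ => ?_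
  exact sum_chain L (fun B D E' => G A (I \ A) (K \ I) B D E')

theorem Grass.one_mul' [CommRing R] (f : Grass d R) : 1 * f = f := by
  funext K L
  rw [Grass.mul_apply, Finset.sum_eq_single ∅, Finset.sum_eq_single ∅]
  · simp [Grass.one_apply, sgnExp, inversions]
  · intro J _ hJ
    simp [Grass.one_apply, hJ]
  · simp
  · intro I _ hI
    simp [Grass.one_apply, hI]
  · simp

theorem Grass.mul_one' [CommRing R] (f : Grass d R) : f * 1 = f := by
  funext K L
  rw [Grass.mul_apply, Finset.sum_eq_single K, Finset.sum_eq_single L]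
  · simp [Grass.one_apply, sgnExp, inversions]
  · intro J hJ hne
    have : L \ J ≠ ∅ := by
      intro h0
      exact hne (Finset.Subset.antisymm (Finset.mem_powerset.1 hJ)
        (Finset.sdiff_eq_empty_iff_subset.1 h0))
    simp [Grass.one_apply, this]
  · simp
  · intro I hI hne
    have : K \ I ≠ ∅ := by
      intro h0
      exact hne (Finset.Subset.antisymm (Finset.mem_powerset.1 hI)
        (Finset.sdiff_eq_empty_iff_subset.1 h0))
    simp [Grass.one_apply, this]
  · simp

instance [CommRing R] : Ring (Grass d R) :=
  { (inferInstance : AddCommGroup (Grass d R)),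
    (inferInstance : Mul (Grass d R)),
    (inferInstance : One (Grass d R)) with
    left_distrib := fun f g h => by
      funext K L
      simp only [Grass.mul_apply, Grass.add_apply, mul_add, Finset.sum_add_distrib]
    right_distrib := fun f g h => by
      funext K L
      simp only [Grass.mul_apply, Grass.add_apply, mul_add, add_mul, Finset.sum_add_distrib]
    zero_mul := fun f => by
      funext K L
      simp [Grass.mul_apply, Grass.zero_apply]
    mul_zero := fun f => by
      funext K L
      simp [Grass.mul_apply, Grass.zero_apply]
    mul_assoc := Grass.mul_assoc'
    one_mul := Grass.one_mul'
    mul_one := Grass.mul_one' }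

/-- `f` is homogeneous of parity `ε`. -/
def Grass.IsHomogeneous [Zero R] (ε : ZMod 2) (f : Grass d R) : Prop :=
  ∀ I J, ((I.card + J.card : ℕ) : ZMod 2) ≠ ε → f I J = 0

end Grassmann

/-! ### Smooth functions, differential operators and formal functions on `U ⊂ ℂ^m` -/

noncomputable section

open TopologicalSpace

variable {m d : ℕ}

/-- Open subsets of `ℂ^m`. -/
abbrev Op (m : ℕ) := Opens (Fin m → ℂ)

open Classical in
/-- Extension by zero of a function on `U` to `ℂ^m` (only its values on `U` matter). -/
def ext0 {U : Op m} (f : U → ℂ) : (Fin m → ℂ) → ℂ :=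
  fun x => if h : x ∈ U then f ⟨x, h⟩ else 0

theorem ext0_of_mem {U : Op m} (f : U → ℂ) {x : Fin m → ℂ} (h : x ∈ U) :
    ext0 f x = f ⟨x, h⟩ := by
  simp [ext0, h]

/-- The algebra of smooth complex valued functions on `U`. -/
def smoothSubalgebra (U : Op m) : Subalgebra ℂ (U → ℂ) where
  carrier := {f | ContDiffOn ℝ ∞ (ext0 f) U}
  mul_mem' {f g} hf hg := (ContDiffOn.mul hf hg).congr fun x hx => by
    simp [ext0_of_mem _ hx]
  add_mem' {f g} hf hg := (ContDiffOn.add hf hg).congr fun x hx => by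
    simp [ext0_of_mem _ hx]
  algebraMap_mem' c := (contDiffOn_const (c := c)).congr fun x hx => by
    simp [ext0_of_mem _ hx]

/-- `C^∞(U)`. -/
abbrev Sm (U : Op m) : Type := smoothSubalgebra U

/-- A smooth function on `U`, extended by zero to `ℂ^m`. -/
def Sm.ext {U : Op m} (f : Sm U) : (Fin m → ℂ) → ℂ := ext0 f.1

/-- Restriction of smooth functions to a smaller open set. -/
def Sm.res {U V : Op m} (h : V ≤ U) : Sm U →ₐ[ℂ] Sm V where
  toFun f := ⟨fun x => f.1 ⟨x.1, h x.2⟩, (f.2.mono h).congr fun x hx => by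
    simp [ext0_of_mem _ hx, ext0_of_mem _ (h hx)]⟩
  map_one' := rfl
  map_mul' _ _ := rfl
  map_zero' := rfl
  map_add' _ _ := rfl
  commutes' _ := rfl

/-- The real directional derivative along the constant vector field `v`. -/
def dirDeriv {U : Op m} (v : Fin m → ℂ) : Module.End ℂ (Sm U) where
  toFun f := ⟨fun x => fderiv ℝ f.ext x.1 v, by
    have h : ContDiffOn ℝ ∞ (fderiv ℝ f.ext) U :=
      ContDiffOn.fderiv_of_isOpen f.2 U.2 (by simp)
    exact (h.clm_apply (contDiffOn_const (c := v))).congr fun x hx => by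
      rw [ext0_of_mem _ hx]⟩
  map_add' f g := by
    ext x
    have hf : DifferentiableAt ℝ f.ext x.1 :=
      (f.2.contDiffAt (U.2.mem_nhds x.2)).differentiableAt (by simp)
    have hg : DifferentiableAt ℝ g.ext x.1 :=
      (g.2.contDiffAt (U.2.mem_nhds x.2)).differentiableAt (by simp)
    have h : (f + g).ext =ᶠ[nhds x.1] fun y => f.ext y + g.ext y :=
      Filter.eventually_of_mem (U.2.mem_nhds x.2) fun y hy => by
        simp [Sm.ext, ext0_of_mem _ (show y ∈ U from hy)]
    simp only [AddMemClass.coe_add, Pi.add_apply]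
    rw [h.fderiv_eq, fderiv_fun_add hf hg]
    rfl
  map_smul' c f := by
    ext x
    have hf : DifferentiableAt ℝ f.ext x.1 :=
      (f.2.contDiffAt (U.2.mem_nhds x.2)).differentiableAt (by simp)
    have h : (c • f).ext =ᶠ[nhds x.1] fun y => c • f.ext y :=
      Filter.eventually_of_mem (U.2.mem_nhds x.2) fun y hy => by
        simp [Sm.ext, ext0_of_mem _ (show y ∈ U from hy)]
    simp only [RingHom.id_apply, SetLike.val_smul, Pi.smul_apply]
    rw [h.fderiv_eq, fderiv_fun_const_smul hf]
    rfl

/-- The Wirtinger derivative `∂/∂z^k = (∂/∂x^k - i ∂/∂y^k)/2`. -/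
def dz {U : Op m} (k : Fin m) : Module.End ℂ (Sm U) :=
  (1 / 2 : ℂ) • (dirDeriv (U := U) (Pi.single k 1) - Complex.I • dirDeriv (U := U) (Pi.single k Complex.I))

/-- The Wirtinger derivative `∂/∂z̄^k = (∂/∂x^k + i ∂/∂y^k)/2`. -/
def dzbar {U : Op m} (k : Fin m) : Module.End ℂ (Sm U) :=
  (1 / 2 : ℂ) • (dirDeriv (U := U) (Pi.single k 1) + Complex.I • dirDeriv (U := U) (Pi.single k Complex.I))

/-- Multi-indices: `α (inl k)` and `α (inr k)` are the orders in `∂/∂z^k` and `∂/∂z̄^k`. -/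
abbrev MI (m : ℕ) : Type := (Fin m ⊕ Fin m) →₀ ℕ

/-- The iterated partial derivative `∂^α`. -/
def partialD {U : Op m} (α : MI m) : Module.End ℂ (Sm U) :=
  ((List.finRange m).map fun k => dz k ^ α (Sum.inl k)).prod *
    ((List.finRange m).map fun k => dzbar k ^ α (Sum.inr k)).prod

/-- Differential operators `∑_α c_α ∂^α` on `U` with smooth coefficients. -/
abbrev DiffOp (U : Op m) : Type := MI m →₀ Sm U

/-- The action of a differential operator on smooth functions. -/
def DiffOp.apply {U : Op m} (D : DiffOp U) (f : Sm U) : Sm U :=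
  D.sum fun α c => c * partialD α f

/-- Restriction of a differential operator to a smaller open set. -/
def DiffOp.res {U V : Op m} (h : V ≤ U) : DiffOp U →+ DiffOp V :=
  Finsupp.mapRange.addMonoidHom (Sm.res h : Sm U →+ Sm V)

/-- Bidifferential operators `(f, g) ↦ ∑_{α, β} c_{αβ} ∂^α f ∂^β g` on `U`. -/
abbrev BiDiffOp (U : Op m) : Type := (MI m × MI m) →₀ Sm U

/-- The action of a bidifferential operator on pairs of smooth functions. -/
def BiDiffOp.apply {U : Op m} (B : BiDiffOp U) (f g : Sm U) : Sm U :=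
  B.sum fun p c => c * partialD p.1 f * partialD p.2 g

/-- Restriction of a bidifferential operator to a smaller open set. -/
def BiDiffOp.res {U V : Op m} (h : V ≤ U) : BiDiffOp U →+ BiDiffOp V :=
  Finsupp.mapRange.addMonoidHom (Sm.res h : Sm U →+ Sm V)

theorem DiffOp.apply_zero {U : Op m} (D : DiffOp U) : D.apply 0 = 0 := by
  simp [DiffOp.apply]

theorem DiffOp.zero_apply {U : Op m} (f : Sm U) : (0 : DiffOp U).apply f = 0 := by
  simp [DiffOp.apply]

theorem BiDiffOp.apply_zero_left {U : Op m} (B : BiDiffOp U) (g : Sm U) : B.apply 0 g = 0 := by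
  simp [BiDiffOp.apply]

theorem BiDiffOp.apply_zero_right {U : Op m} (B : BiDiffOp U) (f : Sm U) : B.apply f 0 = 0 := by
  simp [BiDiffOp.apply]

/-- Formal functions `C^∞(U)[ν⁻¹, ν]]`: Laurent series in `ν` with smooth coefficients. -/
abbrev FF (U : Op m) : Type := LaurentSeries (Sm U)

/-- A smooth function, viewed as a formal function. -/
def toFF {U : Op m} (f : Sm U) : FF U := HahnSeries.C f

/-- Restriction of formal functions. -/
def FF.res {U V : Op m} (h : V ≤ U) (f : FF U) : FF V := HahnSeries.map f (Sm.res h)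

/-- Formal differential operators `∑_{k ≥ r} ν^k A_k`, `r ∈ ℤ`. -/
abbrev FormalDiffOp (U : Op m) : Type := LaurentSeries (DiffOp U)

/-- Restriction of formal differential operators. -/
def FormalDiffOp.res {U V : Op m} (h : V ≤ U) (A : FormalDiffOp U) : FormalDiffOp V :=
  HahnSeries.map A (DiffOp.res h)

/-- The `ν`-linear action of a formal differential operator:
the coefficient of `ν^n` in `A f` is `∑_k A_k f_{n-k}` (a finite sum). -/
def FormalDiffOp.apply {U : Op m} (A : FormalDiffOp U) (f : FF U) : FF U :=
  HahnSeries.ofSuppBddBelow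
    (fun n : ℤ => ∑ᶠ k : ℤ, (A.coeff k).apply (f.coeff (n - k)))
    ⟨A.order + f.order, by
      intro n hn'
      by_contra hn
      rw [not_le] at hn
      refine hn' ?_
      refine finsum_eq_zero_of_forall_eq_zero fun k => ?_
      by_cases hk : k < A.order
      · rw [HahnSeries.coeff_eq_zero_of_lt_order hk, DiffOp.zero_apply]
      · rw [HahnSeries.coeff_eq_zero_of_lt_order (x := f) (by omega), DiffOp.apply_zero]⟩

/-- The `ν`-bilinear product `f ⋆ g = ∑_r ν^r C_r(f, g)`: the coefficient of `ν^n` in `f ⋆ g` is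
`∑_{r + i + j = n} C_r(f_i, g_j)` (a finite sum). -/
def starMul {U : Op m} (C : ℕ → BiDiffOp U) (f g : FF U) : FF U :=
  HahnSeries.ofSuppBddBelow
    (fun n : ℤ => ∑ᶠ p : ℕ × ℤ, (C p.1).apply (f.coeff p.2) (g.coeff (n - p.1 - p.2)))
    ⟨f.order + g.order, by
      intro n hn'
      by_contra hn
      rw [not_le] at hn
      refine hn' ?_
      refine finsum_eq_zero_of_forall_eq_zero fun p => ?_
      by_cases hk : p.2 < f.order
      · rw [HahnSeries.coeff_eq_zero_of_lt_order hk, BiDiffOp.apply_zero_left]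
      · rw [HahnSeries.coeff_eq_zero_of_lt_order (x := g) (by omega), BiDiffOp.apply_zero_right]⟩

/-! ### Star products -/

/-- A star product on `U`: a formal differential deformation, with unit `1`, of the commutative
associative product of smooth functions. -/
structure StarProduct (U : Op m) where
  /-- The bidifferential operators `C_r`. -/
  C : ℕ → BiDiffOp U
  C_zero : ∀ f g : Sm U, (C 0).apply f g = f * g
  assoc : ∀ f g h : FF U, starMul C (starMul C f g) h = starMul C f (starMul C g h)
  one_mul : ∀ f : FF U, starMul C 1 f = f
  mul_one : ∀ f : FF U, starMul C f 1 = f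

namespace StarProduct

variable {U : Op m} (S : StarProduct U)

/-- The star product of formal functions on an open subset `V ⊂ U`. -/
def mulOn {V : Op m} (h : V ≤ U) (f g : FF V) : FF V :=
  starMul (fun r => BiDiffOp.res h (S.C r)) f g

/-- The star product of formal functions on `U`. -/
def mul (f g : FF U) : FF U := starMul S.C f g

end StarProduct

/-- Holomorphic functions on `V`. -/
def IsHol {V : Op m} (a : Sm V) : Prop := DifferentiableOn ℂ a.ext V

/-- Antiholomorphic functions on `V`. -/
def IsAntihol {V : Op m} (b : Sm V) : Prop :=
  DifferentiableOn ℂ (fun x => (starRingEnd ℂ) (b.ext x)) V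

/-- Separation of variables (of the anti-Wick type): `a ⋆ f = a f` and `f ⋆ b = f b` for all
locally defined holomorphic `a` and antiholomorphic `b`. -/
def StarProduct.HasSepVar {U : Op m} (S : StarProduct U) : Prop :=
  ∀ (V : Op m) (h : V ≤ U) (f : FF V),
    (∀ a : Sm V, IsHol a → S.mulOn h (toFF a) f = toFF a * f) ∧
    (∀ b : Sm V, IsAntihol b → S.mulOn h f (toFF b) = f * toFF b)

/-- The coordinate functions `z^k` (on `inl k`) and `z̄^k` (on `inr k`) on `U`. -/
def coord {U : Op m} : Fin m ⊕ Fin m → Sm U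
  | Sum.inl k => ⟨fun x => x.1 k,
      (contDiff_apply ℝ ℂ k).contDiffOn.congr fun x hx => ext0_of_mem _ hx⟩
  | Sum.inr k => ⟨fun x => (starRingEnd ℂ) (x.1 k),
      (Complex.conjCLE.contDiff.comp (contDiff_apply ℝ ℂ k)).contDiffOn.congr
        fun x hx => by rw [ext0_of_mem _ hx]; rfl⟩

/-- The Poisson bracket `{f, g} = -i (C₁(f, g) - C₁(g, f))` induced by a star product. -/
def StarProduct.bracket {U : Op m} (S : StarProduct U) (f g : Sm U) : Sm U :=
  (-Complex.I) • ((S.C 1).apply f g - (S.C 1).apply g f)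

/-- A star product is nondegenerate if the Poisson structure that it induces is nondegenerate:
the matrix of brackets of the coordinates `z^1, …, z^m, z̄^1, …, z̄^m` is invertible at every
point. -/
def StarProduct.IsNondegenerate {U : Op m} (S : StarProduct U) : Prop :=
  ∀ x : U, (Matrix.of fun i j => (S.bracket (coord i) (coord j)).1 x).det ≠ 0

/-- The metric tensor `(g_{kl})` at `x`, the inverse of the Poisson tensor `(g^{lk})`, where
`C₁(f, g) = g^{lk} ∂f/∂z̄^l ∂g/∂z^k`, that is, `g^{lk} = C₁(z̄^l, z^k)`. -/
def StarProduct.metric {U : Op m} (S : StarProduct U) (x : U) : Matrix (Fin m) (Fin m) ℂ :=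
  (Matrix.of fun l k => ((S.C 1).apply (coord (Sum.inr l)) (coord (Sum.inl k))).1 x)⁻¹

/-! ### Formal integrals and the canonical trace density -/

/-- The integral over `U` with respect to Lebesgue measure. -/
def integralHom (U : Op m) : ZeroHom (Sm U) ℂ where
  toFun f := ∫ x in (U : Set (Fin m → ℂ)), f.ext x
  map_zero' := by
    have : (0 : Sm U).ext = 0 := by
      funext x
      simp [Sm.ext, ext0]
    simp [this]

/-- The integral of a formal function with respect to Lebesgue measure, coefficientwise. -/
def fint {U : Op m} (f : FF U) : LaurentSeries ℂ := HahnSeries.map f (integralHom U)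

/-- A formal function has compact support if each of its coefficients does. -/
def IsCpt {U : Op m} (f : FF U) : Prop := ∀ n : ℤ, HasCompactSupport (f.coeff n).1

/-- The formal density `t dz dz̄` is a trace density of `⋆`. -/
def IsTraceDensity {U : Op m} (S : StarProduct U) (t : FF U) : Prop :=
  ∀ f g : FF U, IsCpt f ∨ IsCpt g → fint (S.mul f g * t) = fint (S.mul g f * t)

/-- The formal operator `δ = d/dν + A`. -/
def ddnuAdd {V : Op m} (A : FormalDiffOp V) (f : FF V) : FF V :=
  LaurentSeries.derivative ℂ f + A.apply f

/-- `δ = d/dν + A`, with `A = ν⁻¹ A₋₁ + A₀ + ν A₁ + ⋯`, is a derivation of the restriction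
of `⋆` to `V`. -/
def IsFormalDerivation {U V : Op m} (S : StarProduct U) (h : V ≤ U) (A : FormalDiffOp V) : Prop :=
  (∀ k : ℤ, k < -1 → A.coeff k = 0) ∧
  ∀ f g : FF V, ddnuAdd A (S.mulOn h f g) =
    S.mulOn h (ddnuAdd A f) g + S.mulOn h f (ddnuAdd A g)

/-- `t dz dz̄` is the canonical trace density `μ_⋆` of a nondegenerate star product with separation
of variables `⋆` on `U`, where `dz dz̄` is Lebesgue measure:
* it is a trace density;
* it is of the form `ν^{-m} (ω₋₁^m / m!) exp(κ)` with `κ = ν κ₁ + ν² κ₂ + ⋯`. Here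
  `ω₋₁ = i g_{kl} dz^k ∧ dz̄^l`, and as `i dz^k ∧ dz̄^k = 2 dx^k ∧ dy^k`, the density
  `ω₋₁^m / m!` is `2^m det(g_{kl})` times Lebesgue measure;
* on every contractible open `V ⊂ U`, `d/dν ∫_V f μ_⋆ = ∫_V δ(f) μ_⋆` for all formal derivations
  `δ = d/dν + A` of `⋆` on `V` and all `f` with compact support in `V`. -/
structure IsCanonicalTraceDensity {U : Op m} (S : StarProduct U) (t : FF U) : Prop where
  trace : IsTraceDensity S t
  form : ∃ (w : Sm U) (κ : PowerSeries (Sm U)),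
    (∀ x : U, w.1 x = 2 ^ m * (S.metric x).det) ∧ PowerSeries.constantCoeff κ = 0 ∧
    t = HahnSeries.single (-(m : ℤ)) w *
      HahnSeries.ofPowerSeries ℤ (Sm U) (PowerSeries.subst κ (PowerSeries.exp (Sm U)))
  normalized : ∀ (V : Op m) (h : V ≤ U), ContractibleSpace V →
    ∀ A : FormalDiffOp V, IsFormalDerivation S h A → ∀ f : FF V, IsCpt f →
      LaurentSeries.derivative ℂ (fint (f * FF.res h t)) = fint (ddnuAdd A f * FF.res h t)

/-- `I = 1 + ν I₁ + ν² I₂ + ⋯` is the formal Berezin transform of `⋆`: the formal differential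
operator with `I(b a) = b ⋆ a` for locally defined holomorphic `a` and antiholomorphic `b`. -/
def IsBerezinTransform {U : Op m} (S : StarProduct U) (I : FormalDiffOp U) : Prop :=
  (∀ k : ℤ, k < 0 → I.coeff k = 0) ∧ I.coeff 0 = Finsupp.single 0 1 ∧
  ∀ (V : Op m) (h : V ≤ U) (a b : Sm V), IsHol a → IsAntihol b →
    (I.res h).apply (toFF (b * a)) = S.mulOn h (toFF b) (toFF a)

/-! ### The product on `U × ℂ^{0|d}` associated with `(⋆, u)` -/

/-- Formal functions on `U × ℂ^{0|d}`: `f = ∑ f I J θ^I θ̄^J` with `f I J ∈ C^∞(U)[ν⁻¹, ν]]`. -/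
abbrev SF (d : ℕ) (U : Op m) : Type := Grass d (FF U)

/-- Multiplication of the coefficients of a function on `U × ℂ^{0|d}` by a formal function
on `U`. -/
def SF.mulRight {U : Op m} (f : SF d U) (t : FF U) : SF d U := fun I J => f I J * t

/-- `2^d × 2^d`-matrices over `(C^∞(U)[ν⁻¹, ν]], ⋆)` indexed by the subsets of `{1, …, d}`.
The entry `F K I` is `F_K^I`. -/
abbrev Mat (d : ℕ) (U : Op m) : Type := Finset (Fin d) → Finset (Fin d) → FF U

variable {U : Op m}

/-- The matrix product over `(C^∞(U)[ν⁻¹, ν]], ⋆)`. -/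
def matMul (S : StarProduct U) (F G : Mat d U) : Mat d U :=
  fun K J => ∑ I, S.mul (F K I) (G I J)

/-- The identity matrix. -/
def matOne : Mat d U := fun K I => if K = I then 1 else 0

/-- The matrix `(u_{PQ})` of coefficients of `u = ∑ u_{PQ} θ^P θ̄^Q`. -/
def coeffMat (u : SF d U) : Mat d U := fun P Q => u P Q

/-- `v = (v^{QP})` is the inverse of the matrix `(u_{PQ})` over `(C^∞(U)[ν⁻¹, ν]], ⋆)`. -/
def IsStarInverse (S : StarProduct U) (u : SF d U) (v : Mat d U) : Prop :=
  matMul S (coeffMat u) v = matOne ∧ matMul S v (coeffMat u) = matOne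

/-- `u` is admissible with respect to `⋆`: it is even, `u_{∅∅} = 1`, and the matrix `(u_{PQ})` is
invertible over `(C^∞(U)[ν⁻¹, ν]], ⋆)`. -/
structure IsAdmissible (S : StarProduct U) (u : SF d U) : Prop where
  even : Grass.IsHomogeneous 0 u
  body : u ∅ ∅ = 1
  inverse : ∃ v : Mat d U, IsStarInverse S u v

/-- The map `(F_K^I) ↦ u⁻¹ ∑ (F_K^I ⋆ u_{IL}) θ^K θ̄^L` from matrices to functions, where `u⁻¹` is
the inverse with respect to the supercommutative product. -/
def mop (S : StarProduct U) (u : SF d U) (F : Mat d U) : SF d U :=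
  let w : SF d U := fun K L => ∑ I, S.mul (F K I) (u I L)
  Ring.inverse u * w

/-- The matrix `(f_K^I)` that represents the function `f`. -/
def symbolMat (S : StarProduct U) (u f : SF d U) : Mat d U :=
  Function.invFun (mop S u) f

/-- The product `∗` associated with `(⋆, u)`, transferred from the matrix algebra. -/
def superMul (S : StarProduct U) (u f g : SF d U) : SF d U :=
  mop S u (matMul S (symbolMat S u f) (symbolMat S u g))

/-- A function on `U × ℂ^{0|d}` has compact support if all its coefficients do. -/
def SF.IsCpt (f : SF d U) : Prop := ∀ I J, SuperBerezin.IsCpt (f I J)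

/-- The supertrace `Str(F_K^I) = ∑_I (-1)^{|I|} ∫_U F_I^I μ_⋆`, where `μ_⋆ = t dz dz̄`. -/
def Str (t : FF U) (F : Mat d U) : LaurentSeries ℂ := ∑ I, (-1) ^ I.card * fint (F I I * t)

/-- The canonical supertrace functional `σ(f) = Str(f_K^I)` of the product `∗`. -/
def canonicalSupertrace (S : StarProduct U) (u : SF d U) (t : FF U) (f : SF d U) :
    LaurentSeries ℂ :=
  Str t (symbolMat S u f)

/-- The Berezin integral `∫ f dz dz̄ dθ dθ̄`, where `∫ f dθ dθ̄ = f_{[d][d]}`. -/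
def berezinInt (f : SF d U) : LaurentSeries ℂ := fint (f Finset.univ Finset.univ)

/-- `ρ dz dz̄ dθ dθ̄` is a supertrace density of the product `∗` associated with `(⋆, u)`. -/
def IsSupertraceDensity (S : StarProduct U) (u ρ : SF d U) : Prop :=
  ∀ (ε η : ZMod 2) (f g : SF d U), Grass.IsHomogeneous ε f → Grass.IsHomogeneous η g →
    f.IsCpt ∨ g.IsCpt → berezinInt (superMul S u f g * ρ) =
      (-1) ^ (ε.val * η.val) * berezinInt (superMul S u g f * ρ)

/-- `ρ dz dz̄ dθ dθ̄` represents the canonical supertrace: `σ(f) = ∫ f ρ dz dz̄ dθ dθ̄` for all `f`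
with compact support. -/
def RepresentsSupertrace (S : StarProduct U) (u : SF d U) (t : FF U) (ρ : SF d U) : Prop :=
  ∀ f : SF d U, f.IsCpt → canonicalSupertrace S u t f = berezinInt (f * ρ)

/-- The exponent `ε(I) = α₁ + ⋯ + α_k - k(k+1)/2` for `I = {α₁, …, α_k} ⊂ {1, …, d}` (an element
`α : Fin d` stands for the integer `α + 1`; the difference is never negative). -/
def epsExp (I : Finset (Fin d)) : ℕ := (∑ α ∈ I, (α.val + 1)) - I.card * (I.card + 1) / 2

/-- The exponent `λ(K, Q) = |K'| |Q| + ε(K) + ε(Q)`, where `K'` is the complement of `K`. -/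
def lamExp (K Q : Finset (Fin d)) : ℕ := Kᶜ.card * Q.card + epsExp K + epsExp Q

/-- The function `τ` with `τ_{KQ} = (-1)^{|K'| + λ(K', Q')} I⁻¹(v^{Q'K'})`, where `K'` and `Q'` are
the complements of `K` and `Q`. -/
def tauFn (I : FormalDiffOp U) (v : Mat d U) : SF d U := fun K Q =>
  (-1) ^ (Kᶜ.card + lamExp Kᶜ Qᶜ) * Function.invFun I.apply (v Qᶜ Kᶜ)

end

end SuperBerezin

open SuperBerezin

namespace SuperBerezin

/-! ### Parity in the Grassmann algebra -/

section GrassmannParity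

variable {d : ℕ} {R : Type*}

/-! Since `u` has body 1 it is invertible in the Grassmann algebra, so `mop` can be solved for the
matrix: the symbol of `f` is `(u f) ⋆ v`, with `v` the star inverse of the coefficient matrix of `u`
(`symbolMat_eq`). Hence the canonical supertrace is the sum over `K, L` of `(-1)^|K| ∫ (u f)_{KL} ⋆
v^{LK} μ_⋆`.

The main point is to turn these star products into pointwise products: for a trace density, `∫ f ⋆
I(h) μ_⋆ = ∫ f h μ_⋆` (`IsTraceDensity.fint_star_berezin`). For `h = b a` with `b` antiholomorphic
and `a` holomorphic this is separation of variables plus the trace property: `f ⋆ b ⋆ a = (f b) ⋆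
a`, whose integral is that of `a ⋆ (f b) = a f b`. The exponentials `exp(ζ z + ζ̄ z̄)` have this
form. After integration by parts each coefficient of either side pairs a test function with a
differential operator applied to `h`, and a differential operator that kills all exponentials is
zero, its full symbol at each point being a polynomial with no nonzero values. So the identity holds
for smooth `h`, and by `ν`-adic continuity for formal `h`. The same test by exponentials gives
uniqueness of the Berezin transform; it exists because a bidifferential operator restricted to pairs
(antiholomorphic, holomorphic) is a differential operator in the product; it is invertible because
it is 1 plus terms of positive order in `ν`.

Applied to `h = I⁻¹(v^{LK})`, the identity writes the supertrace as a Berezin integral of `u f`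
against `τ t`: the top Grassmann coefficient pairs `(K, L)` with its complement, and the signs in
`τ` undo the reordering signs. Evenness of `u` lets it pass through `f`. Test functions with a
single Grassmann component determine the density. The supertrace property is the matrix identity for
`Str`, where evenness of `v` ensures that symbols keep parity. -/

theorem inversions_eq_sum (I J : Finset (Fin d)) :
    inversions I J = ∑ i ∈ I, ∑ j ∈ J, if j < i then 1 else 0 := by
  rw [inversions, Finset.card_filter, Finset.sum_product]

/-- Trichotomy: each pair in `I × J` is counted exactly once on the left. -/
theorem inversions_add_inversions (I J : Finset (Fin d)) :
    inversions I J + inversions J I + (I ∩ J).card = I.card * J.card := by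
  have h1 : inversions J I = ∑ i ∈ I, ∑ j ∈ J, if i < j then 1 else 0 := by
    rw [inversions_eq_sum, Finset.sum_comm]
  have h2 : (I ∩ J).card = ∑ i ∈ I, ∑ j ∈ J, if i = j then 1 else 0 := by
    rw [← Finset.filter_mem_eq_inter, Finset.card_filter]
    simp
  rw [h1, h2, inversions_eq_sum, ← Finset.sum_add_distrib, ← Finset.sum_add_distrib]
  simp only [← Finset.sum_add_distrib]
  have : ∀ i j : Fin d, ((if j < i then 1 else 0) + (if i < j then 1 else 0) +
      if i = j then 1 else 0) = 1 := by
    intro i j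
    rcases lt_trichotomy i j with h | h | h
    · simp [h, h.ne, h.not_gt]
    · simp [h]
    · simp [h, h.ne', h.not_gt]
  simp [this]

/-- Each `α ∈ I` exceeds `α.val` indices of `[d]`; discarding the pairs with both members in `I`, of
which there are `k(k-1)/2`, leaves the inversions with the complement. This identifies `ε(I)` with a
reordering sign. -/
theorem inversions_compl (I : Finset (Fin d)) : inversions I Iᶜ = epsExp I := by
  have h1 : inversions I Finset.univ = ∑ α ∈ I, α.val := by
    rw [inversions_eq_sum]
    refine Finset.sum_congr rfl fun i _ => ?_
    rw [← Finset.card_filter, ← Fin.card_Iio i]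
    congr 1
    ext j
    simp
  have hd : Disjoint I Iᶜ := disjoint_compl_right
  have h2 := inversions_union_right I hd
  have hu : I ∪ Iᶜ = Finset.univ := Finset.union_compl I
  rw [hu, h1] at h2
  have h3 := inversions_add_inversions I I
  rw [Finset.inter_self] at h3
  have h4 : I.card * (I.card + 1) / 2 = inversions I I + I.card := by
    rw [mul_add, mul_one, ← h3]
    omega
  rw [epsExp, h4, Finset.sum_add_distrib]
  simp only [Finset.sum_const, smul_eq_mul, mul_one]
  omega

theorem sgnExp_compl (I J : Finset (Fin d)) : sgnExp I J Iᶜ Jᶜ = lamExp I J := by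
  rw [sgnExp, lamExp, inversions_compl, inversions_compl, mul_comm]

/-- This is supercommutativity of monomials: interchanging two of them costs the product of their
degrees. -/
theorem sgnExp_add_sgnExp_comm {I J I' J' : Finset (Fin d)} (hI : Disjoint I I')
    (hJ : Disjoint J J') : sgnExp I J I' J' + sgnExp I' J' I J =
      (I.card + J.card) * (I'.card + J'.card) := by
  have h1 := inversions_add_inversions I I'
  have h2 := inversions_add_inversions J J'
  rw [Finset.disjoint_iff_inter_eq_empty.1 hI, Finset.card_empty, add_zero] at h1
  rw [Finset.disjoint_iff_inter_eq_empty.1 hJ, Finset.card_empty, add_zero] at h2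
  rw [sgnExp, sgnExp, add_mul, mul_add, mul_add, ← h1, ← h2]
  ring

theorem neg_one_pow_eq_of_even_add [CommRing R] {a b : ℕ} (h : Even (a + b)) :
    (-1 : R) ^ a = (-1) ^ b := by
  rcases Nat.even_or_odd a with ha | ha
  · rw [ha.neg_one_pow, ((Nat.even_add.1 h).1 ha).neg_one_pow]
  · have hb : Odd b := by
      rw [← Nat.not_even_iff_odd] at ha ⊢
      exact fun hb => ha ((Nat.even_add.1 h).2 hb)
    rw [ha.neg_one_pow, hb.neg_one_pow]

theorem neg_one_pow_mul_self [CommRing R] (a : ℕ) : (-1 : R) ^ a * (-1) ^ a = 1 := by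
  rw [← mul_pow, neg_one_mul, neg_neg, one_pow]

/-- Even elements of the Grassmann algebra are central. -/
theorem Grass.mul_comm_of_even [CommRing R] {u : Grass d R} (hu : Grass.IsHomogeneous 0 u)
    (f : Grass d R) : f * u = u * f := by
  funext K L
  rw [Grass.mul_apply, Grass.mul_apply]
  have inv : ∀ K : Finset (Fin d), ∀ I ∈ K.powerset, K \ (K \ I) = I := fun K I hI =>
    Finset.sdiff_sdiff_eq_self (Finset.mem_powerset.1 hI)
  refine Finset.sum_nbij' (fun I => K \ I) (fun I => K \ I)
    (fun I _ => Finset.mem_powerset.2 Finset.sdiff_subset)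
    (fun I _ => Finset.mem_powerset.2 Finset.sdiff_subset) (inv K) (inv K) fun I hI => ?_
  refine Finset.sum_nbij' (fun J => L \ J) (fun J => L \ J)
    (fun J _ => Finset.mem_powerset.2 Finset.sdiff_subset)
    (fun J _ => Finset.mem_powerset.2 Finset.sdiff_subset) (inv L) (inv L) fun J hJ => ?_
  rw [inv K I hI, inv L J hJ]
  -- Only even components of `u` survive, and for these the interchange sign is trivial.
  by_cases hp : (((K \ I).card + (L \ J).card : ℕ) : ZMod 2) = 0
  · have he : Even ((K \ I).card + (L \ J).card) := (ZMod.natCast_eq_zero_iff_even).1 hp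
    have hs : Even (sgnExp I J (K \ I) (L \ J) + sgnExp (K \ I) (L \ J) I J) := by
      rw [sgnExp_add_sgnExp_comm Finset.disjoint_sdiff Finset.disjoint_sdiff]
      exact he.mul_left _
    rw [neg_one_pow_eq_of_even_add hs]
    ring
  · rw [hu _ _ hp]
    ring

/-- Without body, every factor contributes at least one odd variable, so `n ^ k` has no terms of
degree below `k`. -/
theorem Grass.pow_apply_eq_zero [CommRing R] {n : Grass d R} (hn : n ∅ ∅ = 0) (k : ℕ)
    (K L : Finset (Fin d)) (h : K.card + L.card < k) : (n ^ k) K L = 0 := by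
  induction k generalizing K L with
  | zero => omega
  | succ k ih =>
    rw [pow_succ', Grass.mul_apply]
    refine Finset.sum_eq_zero fun I hI => Finset.sum_eq_zero fun J hJ => ?_
    rw [Finset.mem_powerset] at hI hJ
    by_cases h0 : I = ∅ ∧ J = ∅
    · rw [h0.1, h0.2, hn]
      ring
    · rw [ih, mul_zero]
      have hI' := Finset.card_sdiff_add_card_eq_card hI
      have hJ' := Finset.card_sdiff_add_card_eq_card hJ
      have : 0 < I.card + J.card := by
        by_contra hc
        refine h0 ⟨Finset.card_eq_zero.1 (by omega), Finset.card_eq_zero.1 (by omega)⟩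
      omega

/-- An element of the Grassmann algebra with body `1` is invertible. -/
theorem Grass.isUnit_of_body [CommRing R] {u : Grass d R} (hu : u ∅ ∅ = 1) : IsUnit u := by
  have hn : (u - 1) ∅ ∅ = 0 := by
    change u ∅ ∅ - (1 : Grass d R) ∅ ∅ = 0
    rw [hu, Grass.one_apply, if_pos ⟨rfl, rfl⟩, sub_self]
  have hnil : IsNilpotent (u - 1) := by
    -- There are `2d` odd variables, hence no terms of degree `2d + 1`.
    refine ⟨2 * d + 1, ?_⟩
    funext K L
    rw [Grass.pow_apply_eq_zero hn _ K L]
    · rfl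
    · have h1 := Finset.card_le_univ K
      have h2 := Finset.card_le_univ L
      rw [Fintype.card_fin] at h1 h2
      omega
  simpa using hnil.isUnit_one_add

theorem Grass.IsHomogeneous.mul [CommRing R] {ε η : ZMod 2} {f g : Grass d R}
    (hf : Grass.IsHomogeneous ε f) (hg : Grass.IsHomogeneous η g) :
    Grass.IsHomogeneous (ε + η) (f * g) := by
  intro K L hKL
  rw [Grass.mul_apply]
  refine Finset.sum_eq_zero fun I hI => Finset.sum_eq_zero fun J hJ => ?_
  rw [Finset.mem_powerset] at hI hJ
  by_cases h1 : ((I.card + J.card : ℕ) : ZMod 2) = ε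
  · rw [hg (K \ I) (L \ J), mul_zero]
    rintro h2
    refine hKL ?_
    rw [← h1, ← h2, ← Finset.card_sdiff_add_card_eq_card hI,
      ← Finset.card_sdiff_add_card_eq_card hJ]
    push_cast
    ring
  · rw [hf _ _ h1]
    ring

/-- The Berezin integral sees only this coefficient; here the exponent `λ` arises as the sign of
joining complementary monomials. -/
theorem Grass.mul_apply_univ [CommRing R] (f g : Grass d R) :
    (f * g) Finset.univ Finset.univ =
      ∑ I, ∑ J, (-1) ^ lamExp I J * f I J * g Iᶜ Jᶜ := by
  rw [Grass.mul_apply]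
  simp only [Finset.powerset_univ, ← Finset.compl_eq_univ_sdiff, sgnExp_compl]

end GrassmannParity

noncomputable section

open TopologicalSpace MeasureTheory

variable {m d : ℕ} {U : Op m}

/-! ### Smooth functions and the calculus of Wirtinger derivatives -/

theorem Sm.ext_apply (f : Sm U) (x : U) : f.ext x.1 = f.1 x := ext0_of_mem _ x.2

theorem Sm.ext_of_notMem (f : Sm U) {x : Fin m → ℂ} (hx : x ∉ U) : f.ext x = 0 := by
  simp [Sm.ext, ext0, hx]

theorem Sm.contDiffAt (f : Sm U) (x : U) : ContDiffAt ℝ ∞ f.ext x.1 :=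
  f.2.contDiffAt (U.2.mem_nhds x.2)

theorem Sm.differentiableAt (f : Sm U) (x : U) : DifferentiableAt ℝ f.ext x.1 :=
  (f.contDiffAt x).differentiableAt (by simp)

theorem Sm.ext_mul (f g : Sm U) (x : Fin m → ℂ) : (f * g).ext x = f.ext x * g.ext x := by
  by_cases hx : x ∈ U
  · simp [Sm.ext, ext0_of_mem _ hx]
  · simp [Sm.ext_of_notMem _ hx]

theorem Sm.ext_add (f g : Sm U) (x : Fin m → ℂ) : (f + g).ext x = f.ext x + g.ext x := by
  by_cases hx : x ∈ U
  · simp [Sm.ext, ext0_of_mem _ hx]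
  · simp [Sm.ext_of_notMem _ hx]

theorem Sm.ext_smul (c : ℂ) (f : Sm U) (x : Fin m → ℂ) : (c • f).ext x = c * f.ext x := by
  by_cases hx : x ∈ U
  · simp [Sm.ext, ext0_of_mem _ hx]
  · simp [Sm.ext_of_notMem _ hx]

theorem dirDeriv_val (v : Fin m → ℂ) (f : Sm U) (x : U) :
    (dirDeriv v f).1 x = fderiv ℝ f.ext x.1 v := rfl

theorem dirDeriv_mul (v : Fin m → ℂ) (f g : Sm U) :
    dirDeriv v (f * g) = dirDeriv v f * g + f * dirDeriv v g := by
  ext x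
  have h : (f * g).ext = f.ext * g.ext := funext (Sm.ext_mul f g)
  rw [dirDeriv_val, h, fderiv_mul (f.differentiableAt x) (g.differentiableAt x)]
  simp [dirDeriv_val, Sm.ext_apply]
  ring

theorem dirDeriv_comm (v w : Fin m → ℂ) (f : Sm U) :
    dirDeriv v (dirDeriv w f) = dirDeriv w (dirDeriv v f) := by
  have key : ∀ v w : Fin m → ℂ, ∀ x : U,
      (dirDeriv v (dirDeriv w f)).1 x = fderiv ℝ (fderiv ℝ f.ext) x.1 v w := by
    intro v w x
    have h : (dirDeriv w f).ext =ᶠ[nhds x.1] fun y => fderiv ℝ f.ext y w :=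
      Filter.eventually_of_mem (U.2.mem_nhds x.2) fun y hy => by
        exact ext0_of_mem _ hy
    have hd : DifferentiableAt ℝ (fderiv ℝ f.ext) x.1 :=
      ((f.contDiffAt x).fderiv_right (m := 1) (by norm_cast)).differentiableAt (by simp)
    rw [dirDeriv_val, h.fderiv_eq, fderiv_clm_apply hd (differentiableAt_const w)]
    simp
  ext x
  rw [key, key]
  exact ((f.contDiffAt x).isSymmSndFDerivAt
    (by simpa using WithTop.coe_le_coe.2 (le_top (a := (2 : ℕ∞))))) v w

/-- The Wirtinger derivatives `∂/∂z^k` (on `inl k`) and `∂/∂z̄^k` (on `inr k`). -/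
def wirt : Fin m ⊕ Fin m → Module.End ℂ (Sm U) := Sum.elim dz dzbar

/-- A common shape for both kinds of Wirtinger derivative, so that the Leibniz rule, commutation and
integration by parts reduce at once to real directional derivatives. -/
theorem wirt_eq (i : Fin m ⊕ Fin m) : ∃ (v w : Fin m → ℂ) (c : ℂ),
    (wirt i : Module.End ℂ (Sm U)) =
      (1 / 2 : ℂ) • (dirDeriv (U := U) v + c • dirDeriv (U := U) w) := by
  rcases i with k | k
  · exact ⟨Pi.single k 1, Pi.single k Complex.I, -Complex.I, LinearMap.ext fun f => by
      change (1 / 2 : ℂ) • (dirDeriv _ f - Complex.I • dirDeriv _ f) =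
        (1 / 2 : ℂ) • (dirDeriv _ f + (-Complex.I) • dirDeriv _ f)
      rw [neg_smul, sub_eq_add_neg]⟩
  · exact ⟨Pi.single k 1, Pi.single k Complex.I, Complex.I, by simp [wirt, dzbar]⟩

theorem wirt_mul (i : Fin m ⊕ Fin m) (f g : Sm U) :
    wirt i (f * g) = wirt i f * g + f * wirt i g := by
  obtain ⟨v, w, c, h⟩ := wirt_eq (U := U) i
  simp only [h, LinearMap.smul_apply, LinearMap.add_apply, dirDeriv_mul, smul_add,
    add_mul, mul_add, smul_mul_assoc, mul_smul_comm]
  abel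

theorem wirt_comm (i j : Fin m ⊕ Fin m) :
    Commute (wirt i : Module.End ℂ (Sm U)) (wirt j) := by
  obtain ⟨v, w, c, h⟩ := wirt_eq (U := U) i
  obtain ⟨v', w', c', h'⟩ := wirt_eq (U := U) j
  have key : ∀ v w, Commute (dirDeriv v : Module.End ℂ (Sm U)) (dirDeriv w) := fun v w =>
    LinearMap.ext fun f => dirDeriv_comm v w f
  rw [h, h']
  refine Commute.smul_left (Commute.smul_right ?_ _) _
  exact ((key _ _).add_right ((key _ _).smul_right _)).add_left
    (((key _ _).add_right ((key _ _).smul_right _)).smul_left _)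

theorem list_prod_pow_add_single {ι M : Type*} [DecidableEq ι] [Monoid M] (F : ι → M)
    (hF : ∀ i j, Commute (F i) (F j)) (α : ι → ℕ) (k : ι) (l : List ι) (hl : l.Nodup) (hk : k ∈ l) :
    (l.map fun j => F j ^ (α j + if j = k then 1 else 0)).prod =
      F k * (l.map fun j => F j ^ α j).prod := by
  induction l with
  | nil => simp at hk
  | cons a l ih =>
    rw [List.nodup_cons] at hl
    simp only [List.map_cons, List.prod_cons]
    by_cases ha : a = k
    · subst ha
      have : (l.map fun j => F j ^ (α j + if j = a then 1 else 0)) = l.map fun j => F j ^ α j := by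
        refine List.map_congr_left fun j hj => ?_
        have : j ≠ a := fun h => hl.1 (h ▸ hj)
        simp [this]
      rw [this, if_pos rfl, pow_succ', mul_assoc]
    · have hk' : k ∈ l := by
        rcases List.mem_cons.1 hk with h | h
        · exact absurd h.symm ha
        · exact h
      rw [ih hl.2 hk', if_neg ha, add_zero, ← mul_assoc, ← mul_assoc,
        ((hF a k).pow_left (α a)).eq]

theorem partialD_zero : (partialD 0 : Module.End ℂ (Sm U)) = 1 := by
  simp [partialD]

/-- The iterated derivative is an ordered product; since the factors commute, an extra one can be
brought to the front. This makes induction on multi-indices possible. -/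
theorem partialD_add_single (α : MI m) (i : Fin m ⊕ Fin m) :
    (partialD (α + Finsupp.single i 1) : Module.End ℂ (Sm U)) = wirt i * partialD α := by
  rcases i with k | k
  · have h := list_prod_pow_add_single (fun j => (dz j : Module.End ℂ (Sm U)))
      (fun i j => wirt_comm (Sum.inl i) (Sum.inl j)) (fun j => α (Sum.inl j)) k
      (List.finRange m) (List.nodup_finRange m) (List.mem_finRange k)
    simp only [partialD, Finsupp.add_apply, Finsupp.single_apply, Sum.inl.injEq, reduceCtorEq,
      if_false, add_zero]
    simp only [eq_comm (a := k)]
    rw [h, mul_assoc]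
    rfl
  · have h := list_prod_pow_add_single (fun j => (dzbar j : Module.End ℂ (Sm U)))
      (fun i j => wirt_comm (Sum.inr i) (Sum.inr j)) (fun j => α (Sum.inr j)) k
      (List.finRange m) (List.nodup_finRange m) (List.mem_finRange k)
    simp only [partialD, Finsupp.add_apply, Finsupp.single_apply, Sum.inr.injEq, reduceCtorEq,
      if_false, add_zero]
    simp only [eq_comm (a := k)]
    rw [h, ← mul_assoc, ← mul_assoc]
    congr 1
    refine Commute.list_prod_left _ _ fun x hx => ?_
    obtain ⟨j, -, rfl⟩ := List.mem_map.1 hx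
    exact (wirt_comm (Sum.inl j) (Sum.inr k)).pow_left _

/-- Induction on multi-indices, raising one exponent at a time. -/
theorem MI.induction {P : MI m → Prop} (h0 : P 0)
    (h1 : ∀ α i, P α → P (α + Finsupp.single i 1)) (α : MI m) : P α := by
  have : ∀ β : MI m, ∀ α, P α → P (α + β) := by
    intro β
    induction β using Finsupp.induction_linear with
    | zero => simp
    | add β γ hβ hγ => intro α hα; rw [← add_assoc]; exact hγ _ (hβ _ hα)
    | single i n =>
      induction n with
      | zero => simp
      | succ n ih => intro α hα; rw [Finsupp.single_add, ← add_assoc]; exact h1 _ _ (ih _ hα)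
  simpa using this α 0 h0

theorem partialD_add (α β : MI m) :
    (partialD (α + β) : Module.End ℂ (Sm U)) = partialD α * partialD β := by
  induction α using MI.induction with
  | h0 => simp [partialD_zero]
  | h1 α i ih => rw [add_right_comm, partialD_add_single, ih, partialD_add_single, mul_assoc]

theorem partialD_comm (α β : MI m) (f : Sm U) :
    partialD α (partialD β f) = partialD β (partialD α f) := by
  have h := partialD_add (U := U) α β
  rw [add_comm, partialD_add] at h
  exact LinearMap.congr_fun h.symm f

/-! ### Exponential functions -/

/-- The real linear function `∑ ζ_k z^k + ∑ ζ̄_k z̄^k`. -/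
def linFn (ζ : Fin m ⊕ Fin m → ℂ) : (Fin m → ℂ) →L[ℝ] ℂ :=
  ∑ k, (ζ (Sum.inl k) • ContinuousLinearMap.proj (R := ℝ) k +
    ζ (Sum.inr k) • (Complex.conjCLE : ℂ →L[ℝ] ℂ).comp (ContinuousLinearMap.proj (R := ℝ) k))

theorem linFn_apply (ζ : Fin m ⊕ Fin m → ℂ) (x : Fin m → ℂ) :
    linFn ζ x = ∑ k, (ζ (Sum.inl k) * x k + ζ (Sum.inr k) * (starRingEnd ℂ) (x k)) := by
  simp [linFn]

/-- The exponential function `exp(∑ ζ_k z^k + ∑ ζ̄_k z̄^k)`. -/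
def expFn (ζ : Fin m ⊕ Fin m → ℂ) : Sm U :=
  ⟨fun x => Complex.exp (linFn ζ x.1),
    ((linFn ζ).contDiff.cexp.contDiffOn).congr fun _ hx => ext0_of_mem _ hx⟩

theorem expFn_val (ζ : Fin m ⊕ Fin m → ℂ) (x : U) :
    (expFn ζ : Sm U).1 x = Complex.exp (linFn ζ x.1) := rfl

theorem expFn_ext_eventuallyEq (ζ : Fin m ⊕ Fin m → ℂ) (x : U) :
    (expFn ζ : Sm U).ext =ᶠ[nhds x.1] fun y => Complex.exp (linFn ζ y) :=
  Filter.eventually_of_mem (U.2.mem_nhds x.2) fun _ hy => ext0_of_mem _ hy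

theorem dirDeriv_expFn (v : Fin m → ℂ) (ζ : Fin m ⊕ Fin m → ℂ) :
    dirDeriv v (expFn ζ : Sm U) = linFn ζ v • expFn ζ := by
  ext x
  rw [dirDeriv_val, (expFn_ext_eventuallyEq ζ x).fderiv_eq,
    ((linFn ζ).hasFDerivAt (x := x.1)).cexp.fderiv]
  simp [expFn_val, mul_comm]

theorem linFn_single (ζ : Fin m ⊕ Fin m → ℂ) (k : Fin m) (c : ℂ) :
    linFn ζ (Pi.single k c) = ζ (Sum.inl k) * c + ζ (Sum.inr k) * (starRingEnd ℂ) c := by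
  rw [linFn_apply, Finset.sum_eq_single k]
  · simp
  · intro j _ hj
    simp [hj]
  · simp

theorem wirt_expFn (i : Fin m ⊕ Fin m) (ζ : Fin m ⊕ Fin m → ℂ) :
    wirt i (expFn ζ : Sm U) = ζ i • expFn ζ := by
  rcases i with k | k
  · have : wirt (Sum.inl k) (expFn ζ : Sm U) = ((1 / 2 : ℂ) * (linFn ζ (Pi.single k 1) -
        Complex.I * linFn ζ (Pi.single k Complex.I))) • expFn ζ := by
      simp [wirt, dz, dirDeriv_expFn, smul_sub, sub_smul, mul_smul, mul_sub]
    rw [this, linFn_single, linFn_single]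
    congr 1
    simp only [map_one, Complex.conj_I]
    linear_combination (-1 / 2 * ζ (Sum.inl k) + 1 / 2 * ζ (Sum.inr k)) * Complex.I_mul_I
  · have : wirt (Sum.inr k) (expFn ζ : Sm U) = ((1 / 2 : ℂ) * (linFn ζ (Pi.single k 1) +
        Complex.I * linFn ζ (Pi.single k Complex.I))) • expFn ζ := by
      simp [wirt, dzbar, dirDeriv_expFn, smul_add, add_smul, mul_smul, mul_add]
    rw [this, linFn_single, linFn_single]
    congr 1
    simp only [map_one, Complex.conj_I]
    linear_combination (1 / 2 * ζ (Sum.inl k) - 1 / 2 * ζ (Sum.inr k)) * Complex.I_mul_I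

theorem partialD_expFn (α : MI m) (ζ : Fin m ⊕ Fin m → ℂ) :
    partialD α (expFn ζ : Sm U) = (α.prod fun i n => ζ i ^ n) • expFn ζ := by
  induction α using MI.induction with
  | h0 => simp [partialD_zero]
  | h1 α i ih =>
    rw [partialD_add_single, Module.End.mul_apply, ih, map_smul, wirt_expFn, smul_smul,
      Finsupp.prod_add_index' (by simp) (fun _ _ _ => pow_add _ _ _)]
    simp

/-- Exponentials are products of an antiholomorphic and a holomorphic function, which is why they
serve as test functions for the Berezin transform. -/
theorem expFn_eq_mul (ζ : Fin m ⊕ Fin m → ℂ) :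
    (expFn ζ : Sm U) = expFn (Sum.elim 0 (ζ ∘ Sum.inr)) * expFn (Sum.elim (ζ ∘ Sum.inl) 0) := by
  ext x
  simp only [MulMemClass.coe_mul, Pi.mul_apply, expFn_val, ← Complex.exp_add]
  congr 1
  simp [linFn_apply, Finset.sum_add_distrib, add_comm]

theorem isHol_expFn (ξ : Fin m → ℂ) : IsHol (expFn (Sum.elim ξ 0) : Sm U) := by
  have : DifferentiableOn ℂ (fun x : Fin m → ℂ => Complex.exp (∑ k, ξ k * x k)) U := by
    fun_prop
  refine this.congr fun x hx => ?_
  rw [Sm.ext, ext0_of_mem _ hx, expFn_val, linFn_apply]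
  simp

theorem isAntihol_expFn (η : Fin m → ℂ) : IsAntihol (expFn (Sum.elim 0 η) : Sm U) := by
  have : DifferentiableOn ℂ
      (fun x : Fin m → ℂ => Complex.exp (∑ k, (starRingEnd ℂ) (η k) * x k)) U := by
    fun_prop
  refine this.congr fun x hx => ?_
  rw [Sm.ext, ext0_of_mem _ hx, expFn_val, linFn_apply, ← Complex.exp_conj]
  simp

/-- A differential operator that annihilates all exponentials vanishes. -/
theorem DiffOp.eq_zero_of_expFn (D : DiffOp U) (h : ∀ ζ, D.apply (expFn ζ) = 0) : D = 0 := by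
  ext α x
  -- The full symbol of `D` at `x`: applying `D` to an exponential multiplies it by the value of
  -- this polynomial at `ζ`.
  let p : MvPolynomial (Fin m ⊕ Fin m) ℂ :=
    ∑ α ∈ D.support, MvPolynomial.monomial α ((D α).1 x)
  have hp : p = 0 := by
    refine MvPolynomial.funext fun ζ => ?_
    have h1 : (D.apply (expFn ζ)).1 x = 0 := by rw [h]; rfl
    have h2 : (D.apply (expFn ζ)).1 x = MvPolynomial.eval ζ p * Complex.exp (linFn ζ x.1) := by
      simp only [DiffOp.apply, Finsupp.sum, p, map_sum, MvPolynomial.eval_monomial, Finset.sum_mul]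
      rw [AddSubmonoidClass.coe_finsetSum, Finset.sum_apply]
      refine Finset.sum_congr rfl fun β _ => ?_
      rw [partialD_expFn]
      simp only [MulMemClass.coe_mul, Pi.mul_apply, SetLike.val_smul, Pi.smul_apply, smul_eq_mul,
        expFn_val, mul_assoc]
    rw [h2] at h1
    simpa using (mul_eq_zero.1 h1).resolve_right (Complex.exp_ne_zero _)
  have hc : MvPolynomial.coeff α p = (D α).1 x := by
    simp only [p, MvPolynomial.coeff_sum, MvPolynomial.coeff_monomial]
    rw [Finset.sum_ite_eq']
    split_ifs with hα
    · rfl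
    · rw [Finsupp.notMem_support_iff.1 hα]; rfl
  rw [← hc, hp]
  rfl

/-! ### Holomorphic and antiholomorphic functions -/

theorem dzbar_eq_zero_of_isHol {a : Sm U} (ha : IsHol a) (k : Fin m) : dzbar k a = 0 := by
  ext x
  have hd : DifferentiableAt ℂ a.ext x.1 := ha.differentiableAt (U.2.mem_nhds x.2)
  have h1 : fderiv ℝ a.ext x.1 (Pi.single k Complex.I) =
      Complex.I * fderiv ℝ a.ext x.1 (Pi.single k 1) := by
    rw [hd.fderiv_restrictScalars ℝ]
    have : (Pi.single k Complex.I : Fin m → ℂ) = Complex.I • Pi.single k 1 := by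
      rw [← Pi.single_smul]; simp
    rw [this]
    simp
  have h2 : (dzbar k a).1 x = (1 / 2 : ℂ) * (fderiv ℝ a.ext x.1 (Pi.single k 1) +
      Complex.I * fderiv ℝ a.ext x.1 (Pi.single k Complex.I)) := rfl
  rw [h2, h1]
  simp only [ZeroMemClass.coe_zero, Pi.zero_apply]
  linear_combination (1 / 2 * fderiv ℝ a.ext x.1 (Pi.single k 1)) * Complex.I_mul_I

/-- Conjugation commutes with real derivatives, so complex linearity of the derivative of the
conjugate becomes conjugate linearity for `b`. -/
theorem dz_eq_zero_of_isAntihol {b : Sm U} (hb : IsAntihol b) (k : Fin m) : dz k b = 0 := by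
  ext x
  have hd : DifferentiableAt ℂ (fun x => (starRingEnd ℂ) (b.ext x)) x.1 :=
    hb.differentiableAt (U.2.mem_nhds x.2)
  have h0 : ∀ v, fderiv ℝ (fun x => (starRingEnd ℂ) (b.ext x)) x.1 v =
      (starRingEnd ℂ) (fderiv ℝ b.ext x.1 v) := by
    intro v
    have := (Complex.conjCLE.toContinuousLinearMap.hasFDerivAt.comp x.1
      (b.differentiableAt x).hasFDerivAt).fderiv
    exact congrArg (fun L : (Fin m → ℂ) →L[ℝ] ℂ => L v) this
  have h1 : fderiv ℝ b.ext x.1 (Pi.single k Complex.I) =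
      -Complex.I * fderiv ℝ b.ext x.1 (Pi.single k 1) := by
    have hv : (Pi.single k Complex.I : Fin m → ℂ) = Complex.I • Pi.single k 1 := by
      rw [← Pi.single_smul]; simp
    apply (starRingEnd ℂ).injective
    rw [map_mul, ← h0, ← h0, hd.fderiv_restrictScalars ℝ, hv]
    simp
  have h2 : (dz k b).1 x = (1 / 2 : ℂ) * (fderiv ℝ b.ext x.1 (Pi.single k 1) -
      Complex.I * fderiv ℝ b.ext x.1 (Pi.single k Complex.I)) := rfl
  rw [h2, h1]
  simp only [ZeroMemClass.coe_zero, Pi.zero_apply]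
  linear_combination (1 / 2 * fderiv ℝ b.ext x.1 (Pi.single k 1)) * Complex.I_mul_I

theorem partialD_eq_zero_of_wirt {f : Sm U} {i : Fin m ⊕ Fin m} (h : wirt i f = 0)
    {α : MI m} (hα : α i ≠ 0) : partialD α f = 0 := by
  have : α = (α - Finsupp.single i 1) + Finsupp.single i 1 := by
    rw [tsub_add_cancel_of_le]
    rw [Finsupp.single_le_iff]
    omega
  rw [this, partialD_add]
  have h1 := partialD_add_single (U := U) 0 i
  rw [zero_add, partialD_zero, mul_one] at h1
  rw [Module.End.mul_apply, h1, h, map_zero]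

/-- `α` involves no derivatives `∂/∂z^k`. -/
def MI.IsAnti (α : MI m) : Prop := ∀ k, α (Sum.inl k) = 0

/-- `α` involves no derivatives `∂/∂z̄^k`. -/
def MI.IsPure (α : MI m) : Prop := ∀ k, α (Sum.inr k) = 0

theorem partialD_antihol_eq_zero {b : Sm U} (hb : IsAntihol b) {α : MI m} (hα : ¬ α.IsAnti) :
    partialD α b = 0 := by
  obtain ⟨k, hk⟩ := not_forall.1 hα
  exact partialD_eq_zero_of_wirt (i := Sum.inl k) (dz_eq_zero_of_isAntihol hb k) hk

theorem partialD_hol_eq_zero {a : Sm U} (ha : IsHol a) {α : MI m} (hα : ¬ α.IsPure) :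
    partialD α a = 0 := by
  obtain ⟨k, hk⟩ := not_forall.1 hα
  exact partialD_eq_zero_of_wirt (i := Sum.inr k) (dzbar_eq_zero_of_isHol ha k) hk

theorem wirt_partialD (i : Fin m ⊕ Fin m) (α : MI m) (f : Sm U) :
    wirt i (partialD α f) = partialD α (wirt i f) := by
  have h1 := partialD_add_single (U := U) 0 i
  rw [zero_add, partialD_zero, mul_one] at h1
  rw [← h1, partialD_comm]

theorem partialD_mul_of_forall (α : MI m) (f g : Sm U) (h : ∀ i, α i ≠ 0 → wirt i g = 0) :
    partialD α (f * g) = partialD α f * g := by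
  induction α using MI.induction with
  | h0 => simp [partialD_zero]
  | h1 α i ih =>
    rw [partialD_add_single, Module.End.mul_apply, Module.End.mul_apply,
      ih fun j hj => h j (by simp [hj]), wirt_mul, h i (by simp), mul_zero, add_zero]

/-- Derivatives in `z̄` treat `a` as a constant and derivatives in `z` treat `b` as one, so no mixed
Leibniz terms occur. -/
theorem partialD_add_mul {a b : Sm U} (ha : IsHol a) (hb : IsAntihol b) {α β : MI m}
    (hα : α.IsAnti) (hβ : β.IsPure) :
    partialD (α + β) (b * a) = partialD α b * partialD β a := by
  rw [add_comm, partialD_add, Module.End.mul_apply, partialD_mul_of_forall, mul_comm,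
    partialD_mul_of_forall, mul_comm]
  · rintro (k | k) hk
    · rw [wirt_partialD]
      simp [wirt, dz_eq_zero_of_isAntihol hb k]
    · exact absurd (hβ k) hk
  · rintro (k | k) hk
    · exact absurd (hα k) hk
    · exact dzbar_eq_zero_of_isHol ha k

/-! ### Integration of compactly supported functions -/

/-- The smooth functions with compact support. -/
def cptSm (U : Op m) : AddSubgroup (Sm U) where
  carrier := {f | HasCompactSupport f.1}
  zero_mem' := HasCompactSupport.zero
  add_mem' hf hg := HasCompactSupport.add hf hg
  neg_mem' {f} hf := HasCompactSupport.mono (f := f.1) hf fun x hx h => hx (by simpa using h)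

theorem cptSm_mul_right {f : Sm U} (hf : f ∈ cptSm U) (g : Sm U) : f * g ∈ cptSm U :=
  HasCompactSupport.mul_right (f := f.1) (f' := g.1) hf

theorem cptSm_mul_left {f : Sm U} (hf : f ∈ cptSm U) (g : Sm U) : g * f ∈ cptSm U :=
  HasCompactSupport.mul_left (f := g.1) (f' := f.1) hf

theorem exists_compact_of_mem_cptSm {f : Sm U} (hf : f ∈ cptSm U) :
    ∃ K : Set (Fin m → ℂ), IsCompact K ∧ K ⊆ U ∧ ∀ x ∉ K, f.ext x = 0 := by
  refine ⟨Subtype.val '' tsupport f.1, IsCompact.image hf continuous_subtype_val, ?_, ?_⟩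
  · rintro _ ⟨x, -, rfl⟩
    exact x.2
  · intro x hx
    by_cases hU : x ∈ U
    · rw [Sm.ext, ext0_of_mem _ hU]
      exact image_eq_zero_of_notMem_tsupport fun h => hx ⟨_, h, rfl⟩
    · exact f.ext_of_notMem hU

theorem tsupport_ext_subset {f : Sm U} (hf : f ∈ cptSm U) : tsupport f.ext ⊆ U := by
  obtain ⟨K, hK, hKU, h⟩ := exists_compact_of_mem_cptSm hf
  refine (closure_minimal (fun x hx => ?_) hK.isClosed).trans hKU
  by_contra hxK
  exact hx (h x hxK)

theorem hasCompactSupport_ext {f : Sm U} (hf : f ∈ cptSm U) : HasCompactSupport f.ext := by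
  obtain ⟨K, hK, -, h⟩ := exists_compact_of_mem_cptSm hf
  exact HasCompactSupport.intro hK h

/-- Points of the support lie inside `U`, where smoothness is given; near any other point the
extension is locally zero. -/
theorem contDiff_ext {f : Sm U} (hf : f ∈ cptSm U) : ContDiff ℝ ∞ f.ext := by
  rw [contDiff_iff_contDiffAt]
  intro x
  by_cases hx : x ∈ tsupport f.ext
  · exact f.contDiffAt ⟨x, tsupport_ext_subset hf hx⟩
  · have : f.ext =ᶠ[nhds x] fun _ => 0 := notMem_tsupport_iff_eventuallyEq.1 hx
    exact contDiffAt_const.congr_of_eventuallyEq this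

theorem integrable_ext {f : Sm U} (hf : f ∈ cptSm U) : Integrable f.ext :=
  (contDiff_ext hf).continuous.integrable_of_hasCompactSupport (hasCompactSupport_ext hf)

theorem integralHom_apply (f : Sm U) : integralHom U f = ∫ x, f.ext x :=
  setIntegral_eq_integral_of_forall_compl_eq_zero fun _ hx => f.ext_of_notMem hx

/-- The integral of a non-integrable function is zero by convention, so additivity requires compact
support; the scalar rule below does not. -/
theorem integralHom_add {f g : Sm U} (hf : f ∈ cptSm U) (hg : g ∈ cptSm U) :
    integralHom U (f + g) = integralHom U f + integralHom U g := by
  simp only [integralHom_apply, Sm.ext_add]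
  exact integral_add (integrable_ext hf) (integrable_ext hg)

theorem integralHom_smul (c : ℂ) (f : Sm U) : integralHom U (c • f) = c * integralHom U f := by
  simp only [integralHom_apply, Sm.ext_smul]
  exact integral_const_mul _ _

theorem integralHom_neg (f : Sm U) : integralHom U (-f) = -integralHom U f := by
  simpa using integralHom_smul (-1) f

theorem dirDeriv_mem_cptSm (v : Fin m → ℂ) {f : Sm U} (hf : f ∈ cptSm U) :
    dirDeriv v f ∈ cptSm U := by
  refine HasCompactSupport.mono' (f := f.1) hf fun x hx => ?_
  by_contra hxs
  refine hx ?_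
  have h0 : f.ext =ᶠ[nhds x.1] fun _ => 0 := by
    have h1 : f.1 =ᶠ[nhds x] 0 := notMem_tsupport_iff_eventuallyEq.1 hxs
    obtain ⟨V, hV, hVo, hxV⟩ := eventually_nhds_iff.1 h1
    refine Filter.eventually_of_mem ((U.2.isOpenMap_subtype_val _ hVo).mem_nhds ⟨x, hxV, rfl⟩) ?_
    rintro _ ⟨y, hy, rfl⟩
    rw [Sm.ext_apply]
    exact hV y hy
  rw [dirDeriv_val, h0.fderiv_eq]
  simp

theorem cptSm_smul (c : ℂ) {f : Sm U} (hf : f ∈ cptSm U) : c • f ∈ cptSm U := by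
  rw [Algebra.smul_def]
  exact cptSm_mul_left hf _

theorem wirt_mem_cptSm (i : Fin m ⊕ Fin m) {f : Sm U} (hf : f ∈ cptSm U) :
    wirt i f ∈ cptSm U := by
  obtain ⟨v, w, c, h⟩ := wirt_eq (U := U) i
  rw [h]
  exact cptSm_smul _ ((cptSm U).add_mem (dirDeriv_mem_cptSm v hf)
    (cptSm_smul _ (dirDeriv_mem_cptSm w hf)))

theorem partialD_mem_cptSm (α : MI m) {f : Sm U} (hf : f ∈ cptSm U) :
    partialD α f ∈ cptSm U := by
  induction α using MI.induction with
  | h0 => simpa [partialD_zero] using hf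
  | h1 α i ih => rw [partialD_add_single]; exact wirt_mem_cptSm i ih

theorem integralHom_dirDeriv_mul (v : Fin m → ℂ) {f : Sm U} (hf : f ∈ cptSm U) (g : Sm U) :
    integralHom U (dirDeriv v f * g) = -integralHom U (f * dirDeriv v g) := by
  -- On the boundary of `U` the extension of a general `g` need not be differentiable. The pointwise
  -- formulas still hold off `U`, as one factor vanishes there.
  have h1 : (dirDeriv v f * g).ext = fun x => fderiv ℝ f.ext x v * g.ext x := by
    funext x
    by_cases hx : x ∈ U
    · rw [Sm.ext_mul]
      congr 1
      exact ext0_of_mem _ hx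
    · rw [Sm.ext_of_notMem _ hx, Sm.ext_of_notMem _ hx, mul_zero]
  have h2 : (f * dirDeriv v g).ext = fun x => f.ext x * fderiv ℝ g.ext x v := by
    funext x
    by_cases hx : x ∈ U
    · rw [Sm.ext_mul]
      congr 1
      exact ext0_of_mem _ hx
    · rw [Sm.ext_of_notMem _ hx, Sm.ext_of_notMem _ hx, zero_mul]
  have h3 : (f * g).ext = fun x => f.ext x * g.ext x := funext (Sm.ext_mul f g)
  have i1 := integrable_ext (cptSm_mul_right (dirDeriv_mem_cptSm v hf) g)
  have i2 := integrable_ext (cptSm_mul_right hf (dirDeriv v g))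
  have i3 := integrable_ext (cptSm_mul_right hf g)
  rw [h1] at i1
  rw [h2] at i2
  rw [h3] at i3
  rw [integralHom_apply, integralHom_apply, h1, h2,
    integral_mul_fderiv_eq_neg_fderiv_mul_of_integrable i1 i2 i3, neg_neg]
  · exact fun x _ => (contDiff_ext hf).differentiable (by simp) x
  · exact fun x hx => g.differentiableAt ⟨x, tsupport_ext_subset hf hx⟩

theorem integralHom_wirt_mul (i : Fin m ⊕ Fin m) {f : Sm U} (hf : f ∈ cptSm U) (g : Sm U) :
    integralHom U (wirt i f * g) = -integralHom U (f * wirt i g) := by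
  obtain ⟨v, w, c, h⟩ := wirt_eq (U := U) i
  simp only [h, LinearMap.smul_apply, LinearMap.add_apply, smul_mul_assoc, mul_smul_comm,
    integralHom_smul, add_mul, mul_add]
  rw [integralHom_add, integralHom_add, integralHom_smul, integralHom_smul,
    integralHom_dirDeriv_mul v hf, integralHom_dirDeriv_mul w hf]
  · ring
  · exact cptSm_mul_right hf _
  · exact cptSm_smul _ (cptSm_mul_right hf _)
  · exact cptSm_mul_right (dirDeriv_mem_cptSm v hf) _
  · exact cptSm_smul _ (cptSm_mul_right (dirDeriv_mem_cptSm w hf) _)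

/-- Repeated integration by parts gives the scalar `(-1)^|α|`; only its independence of `f` and `g`
is needed. -/
theorem integralHom_partialD_mul (α : MI m) : ∃ s : ℂ, ∀ f ∈ cptSm U, ∀ g : Sm U,
    integralHom U (partialD α f * g) = integralHom U (f * (s • partialD α g)) := by
  induction α using MI.induction with
  | h0 => exact ⟨1, fun f _ g => by simp [partialD_zero]⟩
  | h1 α i ih =>
    obtain ⟨s, hs⟩ := ih
    refine ⟨-s, fun f hf g => ?_⟩
    rw [partialD_add_single, Module.End.mul_apply, Module.End.mul_apply,
      integralHom_wirt_mul i (partialD_mem_cptSm α hf), hs f hf, ← wirt_partialD, mul_smul_comm,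
      mul_smul_comm, integralHom_smul, integralHom_smul, neg_mul]

/-- A smooth function whose integral against all compactly supported smooth functions vanishes
is zero. -/
theorem eq_zero_of_integralHom_mul {w : Sm U} (h : ∀ f ∈ cptSm U, integralHom U (f * w) = 0) :
    w = 0 := by
  have hc : ContinuousOn w.ext U := w.2.continuousOn
  have hae := U.2.ae_eq_zero_of_integral_contDiff_smul_eq_zero (μ := volume)
    (hc.locallyIntegrableOn U.2.measurableSet) (fun g hg hgc hgU => by
      -- The fundamental lemma tests with real bump functions supported in `U`; such a function is a
      -- compactly supported element of `Sm U`.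
      let φ : Sm U := ⟨fun x => (g x.1 : ℂ),
        ((Complex.ofRealCLM.contDiff.comp hg).contDiffOn).congr fun x hx => ext0_of_mem _ hx⟩
      have hφ : φ ∈ cptSm U := by
        have hK : IsCompact ((Subtype.val : U → Fin m → ℂ) ⁻¹' tsupport g) := by
          rw [Topology.IsInducing.subtypeVal.isCompact_preimage_iff]
          · exact hgc
          · rintro x hx
            exact ⟨⟨x, hgU hx⟩, rfl⟩
        refine HasCompactSupport.intro hK fun x hx => ?_
        have : g x.1 = 0 := image_eq_zero_of_notMem_tsupport hx
        simp [φ, this]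
      have := h φ hφ
      rw [integralHom_apply] at this
      rw [← this]
      congr 1
      funext x
      rw [Sm.ext_mul]
      by_cases hx : x ∈ U
      · rw [show φ.ext x = (g x : ℂ) from ext0_of_mem _ hx, Complex.real_smul]
      · rw [Sm.ext_of_notMem _ hx, smul_zero, mul_zero])
  have : Set.EqOn w.ext (fun _ => 0) U := by
    refine Measure.eqOn_open_of_ae_eq (μ := volume) ?_ U.2 hc continuousOn_const
    exact (ae_restrict_iff' U.2.measurableSet).2 hae
  ext x
  rw [← Sm.ext_apply, this x.2]
  rfl

/-! ### Differential operators -/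

/-- The map `T` is given by a differential operator. -/
def IsDiff (T : Sm U → Sm U) : Prop := ∃ D : DiffOp U, ∀ f, T f = D.apply f

theorem DiffOp.add_apply (D E : DiffOp U) (f : Sm U) :
    (D + E).apply f = D.apply f + E.apply f :=
  Finsupp.sum_add_index' (by simp) (by simp [add_mul])

theorem DiffOp.single_apply (α : MI m) (c f : Sm U) :
    DiffOp.apply (Finsupp.single α c) f = c * partialD α f :=
  Finsupp.sum_single_index (by simp)

theorem DiffOp.apply_add (D : DiffOp U) (f g : Sm U) :
    D.apply (f + g) = D.apply f + D.apply g := by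
  simp [DiffOp.apply, mul_add, Finsupp.sum_add]

theorem DiffOp.sub_apply (D E : DiffOp U) (f : Sm U) :
    (D - E).apply f = D.apply f - E.apply f := by
  have h : D - E + E = D := sub_add_cancel D E
  rw [eq_sub_iff_add_eq, ← DiffOp.add_apply, h]

theorem DiffOp.isDiff (D : DiffOp U) : IsDiff D.apply := ⟨D, fun _ => rfl⟩

theorem IsDiff.add {T T' : Sm U → Sm U} (h : IsDiff T) (h' : IsDiff T') :
    IsDiff fun f => T f + T' f := by
  obtain ⟨D, hD⟩ := h
  obtain ⟨D', hD'⟩ := h'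
  exact ⟨D + D', fun f => by simp only [DiffOp.add_apply, hD, hD']⟩

theorem IsDiff.zero : IsDiff (fun _ : Sm U => (0 : Sm U)) :=
  ⟨0, fun f => by rw [DiffOp.zero_apply]⟩

theorem IsDiff.mul_left {T : Sm U → Sm U} (h : IsDiff T) (c : Sm U) :
    IsDiff fun f => c * T f := by
  obtain ⟨D, hD⟩ := h
  refine ⟨D.mapRange (fun e => c * e) (mul_zero c), fun f => ?_⟩
  change c * T f = _
  rw [hD, DiffOp.apply, DiffOp.apply, Finsupp.sum_mapRange_index (by simp), Finsupp.mul_sum]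
  simp only [mul_assoc]

theorem IsDiff.wirt {T : Sm U → Sm U} (h : IsDiff T) (i : Fin m ⊕ Fin m) :
    IsDiff fun f => wirt i (T f) := by
  obtain ⟨D, hD⟩ := h
  simp only [hD]
  clear hD
  induction D using Finsupp.induction_linear with
  | zero => simpa [DiffOp.zero_apply] using IsDiff.zero
  | add D E hD hE => simpa [DiffOp.add_apply] using hD.add hE
  | single α c =>
    refine ⟨Finsupp.single α (SuperBerezin.wirt i c) +
      Finsupp.single (α + Finsupp.single i 1) c, fun f => ?_⟩
    simp [DiffOp.add_apply, DiffOp.single_apply, wirt_mul, partialD_add_single]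

theorem IsDiff.partialD {T : Sm U → Sm U} (h : IsDiff T) (α : MI m) :
    IsDiff fun f => partialD α (T f) := by
  induction α using MI.induction with
  | h0 => simpa [partialD_zero] using h
  | h1 α i ih => simpa [partialD_add_single] using ih.wirt i

theorem IsDiff.smul {T : Sm U → Sm U} (h : IsDiff T) (c : ℂ) : IsDiff fun f => c • T f := by
  simpa only [Algebra.smul_def] using h.mul_left (algebraMap ℂ (Sm U) c)

theorem IsDiff.eq_zero_of_expFn {T : Sm U → Sm U} (h : IsDiff T) (h0 : ∀ ζ, T (expFn ζ) = 0)
    (f : Sm U) : T f = 0 := by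
  obtain ⟨D, hD⟩ := h
  rw [hD, D.eq_zero_of_expFn fun ζ => by rw [← hD, h0], DiffOp.zero_apply]

/-- After integration by parts, `∫ B(φ, ψ) = ∫ φ P(ψ)` for a differential operator `P`. -/
def IsTransposable (B : Sm U → Sm U → Sm U) : Prop :=
  (∀ φ ∈ cptSm U, ∀ ψ, B φ ψ ∈ cptSm U) ∧
    ∃ P : Sm U → Sm U, IsDiff P ∧ ∀ φ ∈ cptSm U, ∀ ψ,
      integralHom U (B φ ψ) = integralHom U (φ * P ψ)

theorem IsTransposable.add {B B' : Sm U → Sm U → Sm U} (h : IsTransposable B)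
    (h' : IsTransposable B') : IsTransposable fun φ ψ => B φ ψ + B' φ ψ := by
  obtain ⟨hc, P, hP, hB⟩ := h
  obtain ⟨hc', P', hP', hB'⟩ := h'
  refine ⟨fun φ hφ ψ => (cptSm U).add_mem (hc φ hφ ψ) (hc' φ hφ ψ), _, hP.add hP',
    fun φ hφ ψ => ?_⟩
  rw [integralHom_add (hc φ hφ ψ) (hc' φ hφ ψ), hB φ hφ, hB' φ hφ, mul_add,
    integralHom_add (cptSm_mul_right hφ _) (cptSm_mul_right hφ _)]

theorem IsTransposable.zero : IsTransposable (fun _ _ => (0 : Sm U)) :=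
  ⟨fun _ _ _ => (cptSm U).zero_mem, _, IsDiff.zero, fun φ _ ψ => by simp⟩

theorem IsTransposable.sum {ι : Type*} (s : Finset ι) {B : ι → Sm U → Sm U → Sm U}
    (h : ∀ i ∈ s, IsTransposable (B i)) : IsTransposable fun φ ψ => ∑ i ∈ s, B i φ ψ := by
  classical
  induction s using Finset.induction_on with
  | empty => simpa using IsTransposable.zero
  | insert i s hi ih =>
    simp only [Finset.sum_insert hi]
    exact (h i (Finset.mem_insert_self i s)).add
      (ih fun j hj => h j (Finset.mem_insert_of_mem hj))

theorem BiDiffOp.add_apply (D E : BiDiffOp U) (f g : Sm U) :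
    (D + E).apply f g = D.apply f g + E.apply f g :=
  Finsupp.sum_add_index' (by simp) (by simp [add_mul])

theorem BiDiffOp.single_apply (p : MI m × MI m) (c f g : Sm U) :
    BiDiffOp.apply (Finsupp.single p c) f g = c * partialD p.1 f * partialD p.2 g :=
  Finsupp.sum_single_index (by simp)

theorem BiDiffOp.apply_add_left (B : BiDiffOp U) (f g h : Sm U) :
    B.apply (f + g) h = B.apply f h + B.apply g h := by
  simp [BiDiffOp.apply, mul_add, add_mul, Finsupp.sum_add]

theorem BiDiffOp.apply_add_right (B : BiDiffOp U) (f g h : Sm U) :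
    B.apply f (g + h) = B.apply f g + B.apply f h := by
  simp [BiDiffOp.apply, mul_add, Finsupp.sum_add]

theorem BiDiffOp.apply_mem_cptSm (B : BiDiffOp U) {f g : Sm U} (h : f ∈ cptSm U ∨ g ∈ cptSm U) :
    B.apply f g ∈ cptSm U := by
  refine (cptSm U).sum_mem fun p _ => ?_
  rcases h with h | h
  · exact cptSm_mul_right (cptSm_mul_left (partialD_mem_cptSm _ h) _) _
  · exact cptSm_mul_left (partialD_mem_cptSm _ h) _

/-- The derivatives on `φ` are moved by parts onto everything else. In the application `T` is a
coefficient of the Berezin transform and `c` a coefficient of the trace density. -/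
theorem BiDiffOp.isTransposable (B : BiDiffOp U) {T : Sm U → Sm U} (hT : IsDiff T) (c : Sm U) :
    IsTransposable fun φ ψ => B.apply φ (T ψ) * c := by
  induction B using Finsupp.induction_linear with
  | zero => simpa [BiDiffOp.apply] using IsTransposable.zero
  | add D E hD hE => simpa only [BiDiffOp.add_apply, add_mul] using hD.add hE
  | single p e =>
    obtain ⟨s, hs⟩ := integralHom_partialD_mul (U := U) p.1
    refine ⟨fun φ hφ ψ => cptSm_mul_right (BiDiffOp.apply_mem_cptSm _ (Or.inl hφ)) _,
      fun ψ => s • partialD p.1 ((e * c) * partialD p.2 (T ψ)),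
      (((hT.partialD p.2).mul_left _).partialD p.1).smul s, fun φ hφ ψ => ?_⟩
    change integralHom U (BiDiffOp.apply _ φ (T ψ) * c) = _
    rw [← hs φ hφ, BiDiffOp.single_apply]
    congr 1
    ring

local instance : CommRing (Sm U) := inferInstance

local instance : AddCommGroup (Sm U) := inferInstance

local instance : AddCommGroup (FF U) := inferInstanceAs (AddCommGroup (HahnSeries ℤ (Sm U)))

local instance : AddGroup (FF U) := inferInstance

/-! ### Coefficients of products of formal functions -/

theorem exists_lower_bound {R : Type*} [Zero R] (f : LaurentSeries R) :
    ∃ a : ℤ, ∀ i < a, f.coeff i = 0 :=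
  ⟨f.order, fun _ hi => HahnSeries.coeff_eq_zero_of_lt_order hi⟩

/-- The summation range depends only on the lower bounds, not on the supports, so one finite sum
serves for whole families of series. -/
theorem laurent_mul_coeff {R : Type*} [CommRing R] {x y : LaurentSeries R} {a b : ℤ}
    (hx : ∀ i < a, x.coeff i = 0) (hy : ∀ i < b, y.coeff i = 0) (n : ℤ) :
    (x * y).coeff n = ∑ i ∈ Finset.Icc a (n - b), x.coeff i * y.coeff (n - i) := by
  rw [HahnSeries.coeff_mul]
  refine Finset.sum_of_injOn Prod.fst ?_ ?_ ?_ ?_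
  · rintro ⟨i, j⟩ h ⟨i', j'⟩ h' (rfl : i = i')
    simp only [Finset.mem_coe, Finset.mem_antidiagonal] at h h'
    have : j = j' := by omega
    rw [this]
  · rintro ⟨i, j⟩ h
    simp only [Finset.mem_coe, Finset.mem_antidiagonal, HahnSeries.mem_support] at h
    have h1 : a ≤ i := by
      by_contra hlt
      exact h.1 (hx i (not_le.1 hlt))
    have h2 : b ≤ j := by
      by_contra hlt
      exact h.2.1 (hy j (not_le.1 hlt))
    simp only [Finset.coe_Icc, Set.mem_Icc]
    omega
  · intro i _ hi
    by_contra hne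
    refine hi ⟨(i, n - i), ?_, rfl⟩
    simp only [Finset.mem_coe, Finset.mem_antidiagonal, HahnSeries.mem_support]
    exact ⟨left_ne_zero_of_mul hne, right_ne_zero_of_mul hne, by omega⟩
  · rintro ⟨i, j⟩ h
    simp only [Finset.mem_antidiagonal] at h
    have : n - i = j := by omega
    simp [this]

theorem laurent_mul_coeff_of_lt {R : Type*} [CommRing R] {x y : LaurentSeries R} {a b : ℤ}
    (hx : ∀ i < a, x.coeff i = 0) (hy : ∀ i < b, y.coeff i = 0) {n : ℤ} (hn : n < a + b) :
    (x * y).coeff n = 0 := by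
  rw [laurent_mul_coeff hx hy, Finset.Icc_eq_empty (by omega), Finset.sum_empty]

theorem starMul_coeff (C : ℕ → BiDiffOp U) (f g : FF U) (n : ℤ) :
    (starMul C f g).coeff n =
      ∑ᶠ p : ℕ × ℤ, (C p.1).apply (f.coeff p.2) (g.coeff (n - p.1 - p.2)) := rfl

theorem starMul_support_subset (C : ℕ → BiDiffOp U) {f g : FF U} {a b : ℤ}
    (hf : ∀ i < a, f.coeff i = 0) (hg : ∀ i < b, g.coeff i = 0) (n : ℤ) :
    (Function.support fun p : ℕ × ℤ =>
      (C p.1).apply (f.coeff p.2) (g.coeff (n - p.1 - p.2))) ⊆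
      ↑(Finset.range (n - a - b + 1).toNat ×ˢ Finset.Icc a (n - b)) := by
  rintro ⟨r, i⟩ h
  rw [Function.mem_support] at h
  have h1 : a ≤ i := by
    by_contra hlt
    exact h (by rw [hf i (not_le.1 hlt), BiDiffOp.apply_zero_left])
  have h2 : b ≤ n - r - i := by
    by_contra hlt
    exact h (by rw [hg _ (not_le.1 hlt), BiDiffOp.apply_zero_right])
  simp only [Finset.coe_product, Finset.coe_range, Finset.coe_Icc, Set.mem_prod, Set.mem_Iio,
    Set.mem_Icc]
  omega

theorem starMul_support_finite (C : ℕ → BiDiffOp U) (f g : FF U) (n : ℤ) :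
    (Function.support fun p : ℕ × ℤ =>
      (C p.1).apply (f.coeff p.2) (g.coeff (n - p.1 - p.2))).Finite := by
  obtain ⟨a, ha⟩ := exists_lower_bound f
  obtain ⟨b, hb⟩ := exists_lower_bound g
  exact (Finset.finite_toSet _).subset (starMul_support_subset C ha hb n)

theorem starMul_coeff_of_lt (C : ℕ → BiDiffOp U) {f g : FF U} {a b : ℤ}
    (hf : ∀ i < a, f.coeff i = 0) (hg : ∀ i < b, g.coeff i = 0) {n : ℤ} (hn : n < a + b) :
    (starMul C f g).coeff n = 0 := by
  have h := starMul_support_subset C hf hg n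
  rw [show (n - a - b + 1).toNat = 0 by omega] at h
  exact finsum_eq_zero_of_forall_eq_zero fun p => by
    by_contra hp
    simpa using h hp

theorem starMul_add_left (C : ℕ → BiDiffOp U) (f f' g : FF U) :
    starMul C (f + f') g = starMul C f g + starMul C f' g := by
  ext1
  funext n
  refine Eq.trans (finsum_congr fun p => ?_)
    (finsum_add_distrib (starMul_support_finite C f g n) (starMul_support_finite C f' g n))
  rw [HahnSeries.coeff_add, BiDiffOp.apply_add_left]

theorem starMul_add_right (C : ℕ → BiDiffOp U) (f g g' : FF U) :
    starMul C f (g + g') = starMul C f g + starMul C f g' := by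
  ext1
  funext n
  refine Eq.trans (finsum_congr fun p => ?_)
    (finsum_add_distrib (starMul_support_finite C f g n) (starMul_support_finite C f g' n))
  rw [HahnSeries.coeff_add, BiDiffOp.apply_add_right]

theorem starMul_zero_left (C : ℕ → BiDiffOp U) (g : FF U) : starMul C 0 g = 0 := by
  simpa using starMul_add_left C 0 0 g

theorem starMul_zero_right (C : ℕ → BiDiffOp U) (f : FF U) : starMul C f 0 = 0 := by
  simpa using starMul_add_right C f 0 0

/-- The range is the same for all `φ` and all such `g`, so the coefficient is a fixed finite sum of
bidifferential expressions. -/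
theorem starMul_single_left_coeff (C : ℕ → BiDiffOp U) (i : ℤ) (φ : Sm U) {g : FF U}
    (hg : ∀ k < 0, g.coeff k = 0) (n : ℤ) :
    (starMul C (HahnSeries.single i φ) g).coeff n =
      ∑ r ∈ Finset.range (n - i + 1).toNat, (C r).apply φ (g.coeff (n - i - r)) := by
  have hs : (Function.support fun p : ℕ × ℤ => (C p.1).apply
      ((HahnSeries.single i φ).coeff p.2) (g.coeff (n - p.1 - p.2))) ⊆
      ↑(Finset.range (n - i + 1).toNat ×ˢ ({i} : Finset ℤ)) := by
    rintro ⟨r, k⟩ h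
    rw [Function.mem_support] at h
    have h1 : k = i := by
      by_contra hne
      exact h (by rw [HahnSeries.coeff_single_of_ne hne, BiDiffOp.apply_zero_left])
    subst h1
    have h2 : 0 ≤ n - r - k := by
      by_contra hlt
      exact h (by rw [hg _ (not_le.1 hlt), BiDiffOp.apply_zero_right])
    simp only [Finset.coe_product, Finset.coe_range, Finset.coe_singleton, Set.mem_prod,
      Set.mem_Iio, Set.mem_singleton_iff, and_true]
    omega
  refine Eq.trans (finsum_eq_sum_of_support_subset _ hs) ?_
  rw [Finset.sum_product]
  refine Finset.sum_congr rfl fun r _ => ?_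
  rw [Finset.sum_singleton, HahnSeries.coeff_single_same]
  congr 2
  ring

theorem starMul_toFF_coeff (C : ℕ → BiDiffOp U) (f g : Sm U) (n : ℕ) :
    (starMul C (toFF f) (toFF g)).coeff n = (C n).apply f g := by
  refine Eq.trans (finsum_eq_single _ (n, 0) ?_) ?_
  · rintro ⟨r, k⟩ hne
    by_cases hk : k = 0
    · have : (n : ℤ) - r - k ≠ 0 := by
        rintro h
        refine hne (Prod.ext ?_ hk)
        change r = n
        omega
      simp only [toFF, HahnSeries.C_apply]
      rw [HahnSeries.coeff_single_of_ne this, BiDiffOp.apply_zero_right]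
    · simp only [toFF, HahnSeries.C_apply]
      rw [HahnSeries.coeff_single_of_ne hk, BiDiffOp.apply_zero_left]
  · simp [toFF]

theorem toFF_coeff_of_lt {f : Sm U} {i : ℤ} (hi : i < 0) : (toFF f).coeff i = 0 :=
  HahnSeries.coeff_single_of_ne hi.ne

/-- By `ν`-bilinearity a power of `ν` may pass from one factor to the other: shift the summation
index by `j`. -/
theorem starMul_single_one_mul (C : ℕ → BiDiffOp U) (j : ℤ) (f g : FF U) :
    starMul C f (HahnSeries.single j 1 * g) = starMul C (HahnSeries.single j 1 * f) g := by
  ext1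
  funext n
  let F : ℕ × ℤ → Sm U := fun p => (C p.1).apply ((HahnSeries.single j 1 * f).coeff p.2)
    (g.coeff (n - p.1 - p.2))
  let e : ℕ × ℤ ≃ ℕ × ℤ := (Equiv.refl ℕ).prodCongr (Equiv.addRight j)
  have h : ∑ᶠ p, F (e p) = ∑ᶠ p, F p := finsum_comp_equiv e
  rw [starMul_coeff, starMul_coeff]
  refine Eq.trans (finsum_congr fun p => ?_) h
  simp only [F, e]
  simp only [HahnSeries.coeff_single_mul, one_mul, Equiv.prodCongr_apply, Prod.map,
    Equiv.refl_apply, Equiv.coe_addRight, add_sub_cancel_right]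
  congr 2
  ring

/-! ### Formal differential operators -/

theorem FormalDiffOp.support_finite (A : FormalDiffOp U) (f : FF U) (n : ℤ) :
    (Function.support fun k : ℤ => (A.coeff k).apply (f.coeff (n - k))).Finite := by
  obtain ⟨a, ha⟩ := exists_lower_bound A
  obtain ⟨b, hb⟩ := exists_lower_bound f
  refine (Finset.finite_toSet (Finset.Icc a (n - b))).subset fun k h => ?_
  rw [Function.mem_support] at h
  have h1 : a ≤ k := by
    by_contra hlt
    exact h (by rw [ha k (not_le.1 hlt), DiffOp.zero_apply])
  have h2 : b ≤ n - k := by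
    by_contra hlt
    exact h (by rw [hb _ (not_le.1 hlt), DiffOp.apply_zero])
  simp only [Finset.coe_Icc, Set.mem_Icc]
  omega

theorem FormalDiffOp.apply_add (A : FormalDiffOp U) (f g : FF U) :
    A.apply (f + g) = A.apply f + A.apply g := by
  ext1
  funext n
  refine Eq.trans (finsum_congr fun p => ?_)
    (finsum_add_distrib (A.support_finite f n) (A.support_finite g n))
  rw [HahnSeries.coeff_add, DiffOp.apply_add]

theorem FormalDiffOp.apply_single_coeff (A : FormalDiffOp U) (j : ℤ) (f : Sm U) (n : ℤ) :
    (A.apply (HahnSeries.single j f)).coeff n = (A.coeff (n - j)).apply f := by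
  refine Eq.trans (finsum_eq_single _ (n - j) ?_) ?_
  · intro k hk
    rw [HahnSeries.coeff_single_of_ne (by omega), DiffOp.apply_zero]
  · rw [sub_sub_cancel, HahnSeries.coeff_single_same]

theorem FormalDiffOp.apply_toFF_coeff (A : FormalDiffOp U) (f : Sm U) (n : ℤ) :
    (A.apply (toFF f)).coeff n = (A.coeff n).apply f := by
  rw [toFF, HahnSeries.C_apply, A.apply_single_coeff, sub_zero]

theorem FormalDiffOp.apply_single (A : FormalDiffOp U) (j : ℤ) (f : Sm U) :
    A.apply (HahnSeries.single j f) = HahnSeries.single j 1 * A.apply (toFF f) := by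
  ext1
  funext n
  rw [A.apply_single_coeff, HahnSeries.coeff_single_mul, A.apply_toFF_coeff, one_mul]

theorem FormalDiffOp.apply_coeff {A : FormalDiffOp U} (hA : ∀ k < 0, A.coeff k = 0) {f : FF U}
    {b : ℤ} (hf : ∀ i < b, f.coeff i = 0) (j : ℕ) :
    (A.apply f).coeff (b + j) =
      ∑ i ∈ Finset.range (j + 1), (A.coeff (j - i)).apply (f.coeff (b + i)) := by
  have hs : (Function.support fun k : ℤ => (A.coeff k).apply (f.coeff (b + j - k))) ⊆
      ↑((Finset.range (j + 1)).image fun i : ℕ => (j : ℤ) - i) := by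
    intro k h
    rw [Function.mem_support] at h
    have h1 : 0 ≤ k := by
      by_contra hlt
      exact h (by rw [hA k (not_le.1 hlt), DiffOp.zero_apply])
    have h2 : b ≤ b + j - k := by
      by_contra hlt
      exact h (by rw [hf _ (not_le.1 hlt), DiffOp.apply_zero])
    simp only [Finset.coe_image, Finset.coe_range, Set.mem_image, Set.mem_Iio]
    exact ⟨((j : ℤ) - k).toNat, by omega, by omega⟩
  refine Eq.trans (finsum_eq_sum_of_support_subset _ hs) ?_
  rw [Finset.sum_image (fun x _ y _ h => by omega)]
  refine Finset.sum_congr rfl fun i _ => ?_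
  congr 2
  ring

theorem FormalDiffOp.apply_coeff_of_lt {A : FormalDiffOp U} (hA : ∀ k < 0, A.coeff k = 0)
    {f : FF U} {b : ℤ} (hf : ∀ i < b, f.coeff i = 0) {n : ℤ} (hn : n < b) :
    (A.apply f).coeff n = 0 := by
  refine finsum_eq_zero_of_forall_eq_zero fun k => ?_
  by_cases hk : k < 0
  · rw [hA k hk, DiffOp.zero_apply]
  · rw [hf _ (by omega), DiffOp.apply_zero]

theorem DiffOp.apply_single_zero_one (f : Sm U) :
    DiffOp.apply (Finsupp.single 0 1) f = f := by
  rw [DiffOp.single_apply, partialD_zero, one_mul, Module.End.one_apply]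

/-- The coefficients of the solution `f` of `A f = g`, where `A = 1 + ν A₁ + ν² A₂ + ⋯`. -/
def invCoeff (A : ℤ → DiffOp U) (g : ℕ → Sm U) (j : ℕ) : Sm U :=
  g j - ∑ i : Fin j, (A ((j : ℤ) - i)).apply (invCoeff A g i)
termination_by j
decreasing_by exact i.2

/-- The equation `A f = g` is triangular: its coefficient of order `b + j` contains `f` at that
order plus operators applied to lower coefficients. Induction gives injectivity, recursion gives a
solution. -/
theorem FormalDiffOp.bijective {A : FormalDiffOp U} (hA : ∀ k < 0, A.coeff k = 0)
    (hA0 : A.coeff 0 = Finsupp.single 0 1) : Function.Bijective A.apply := by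
  have key : ∀ {f : FF U} {b : ℤ} (_ : ∀ i < b, f.coeff i = 0) (j : ℕ),
      (A.apply f).coeff (b + j) = f.coeff (b + j) +
        ∑ i ∈ Finset.range j, (A.coeff (j - i)).apply (f.coeff (b + i)) := by
    intro f b hf j
    rw [FormalDiffOp.apply_coeff hA hf, Finset.sum_range_succ, add_comm, sub_self, hA0,
      DiffOp.apply_single_zero_one]
  refine ⟨fun f g hfg => ?_, fun g => ?_⟩
  · obtain ⟨b, hb⟩ := exists_lower_bound (f - g)
    have h0 : A.apply (f - g) = 0 := by
      have := A.apply_add (f - g) g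
      rw [sub_add_cancel, hfg] at this
      exact left_eq_add.1 (by rwa [add_comm])
    have h1 : ∀ j : ℕ, (f - g).coeff (b + j) = 0 := by
      intro j
      induction j using Nat.strong_induction_on with
      | _ j ih =>
        have h2 := key hb j
        rw [h0, HahnSeries.coeff_zero, Finset.sum_eq_zero, add_zero] at h2
        · exact h2.symm
        · intro i hi
          rw [ih i (Finset.mem_range.1 hi), DiffOp.apply_zero]
    rw [← sub_eq_zero]
    ext1
    funext n
    by_cases hn : n < b
    · rw [hb n hn]; rfl
    · have := h1 (n - b).toNat
      rwa [Int.toNat_of_nonneg (by omega), add_sub_cancel] at this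
  · obtain ⟨b, hb⟩ := exists_lower_bound g
    let c : ℕ → Sm U := invCoeff A.coeff fun j => g.coeff (b + j)
    -- As `A` starts with 1, the solution can be taken to start at the lower bound of `g`.
    let f : FF U := HahnSeries.ofSuppBddBelow (fun n : ℤ => if n < b then 0 else c (n - b).toNat)
      ⟨b, fun n hn => by
        by_contra hlt
        exact hn (if_pos (not_le.1 hlt))⟩
    have hf : ∀ i < b, f.coeff i = 0 := fun i hi => if_pos hi
    have hfc : ∀ j : ℕ, f.coeff (b + j) = c j := fun j => by
      have : f.coeff (b + j) = if b + (j : ℤ) < b then 0 else c (b + j - b).toNat := rfl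
      rw [this, if_neg (by omega)]
      congr 1
      omega
    refine ⟨f, ?_⟩
    ext1
    funext n
    by_cases hn : n < b
    · rw [FormalDiffOp.apply_coeff_of_lt hA hf hn, hb n hn]
    · obtain ⟨j, rfl⟩ : ∃ j : ℕ, n = b + j := ⟨(n - b).toNat, by omega⟩
      rw [key hf, hfc]
      have hc : c j = g.coeff (b + j) - ∑ i : Fin j, (A.coeff ((j : ℤ) - i)).apply (c i) := by
        simp only [c]
        rw [invCoeff]
      simp only [hfc]
      rw [hc, ← Fin.sum_univ_eq_sum_range (fun i => (A.coeff ((j : ℤ) - i)).apply (c i)),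
        sub_add_cancel]

/-! ### The formal Berezin transform -/

open Classical in
/-- The differential operator that maps `b a` to `B(b, a)` for `a` holomorphic and `b`
antiholomorphic. -/
def BiDiffOp.contract (B : BiDiffOp U) : DiffOp U :=
  B.sum fun p c => if p.1.IsAnti ∧ p.2.IsPure then Finsupp.single (p.1 + p.2) c else 0

theorem BiDiffOp.contract_add (B B' : BiDiffOp U) :
    (B + B').contract = B.contract + B'.contract := by
  refine Finsupp.sum_add_index' (by simp) fun p c c' => ?_
  split_ifs
  · exact Finsupp.single_add _ _ _
  · simp

/-- A term with a `z`-derivative on `b` or a `z̄`-derivative on `a` vanishes; in the remaining terms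
the two derivatives combine into a single one of the product. -/
theorem BiDiffOp.contract_res_apply {V : Op m} (h : V ≤ U) (B : BiDiffOp U) {a b : Sm V}
    (ha : IsHol a) (hb : IsAntihol b) :
    (DiffOp.res h B.contract).apply (b * a) = (BiDiffOp.res h B).apply b a := by
  induction B using Finsupp.induction_linear with
  | zero => simp [BiDiffOp.contract, DiffOp.zero_apply, BiDiffOp.apply]
  | add D E hD hE =>
    rw [BiDiffOp.contract_add, map_add, map_add, DiffOp.add_apply, BiDiffOp.add_apply, hD, hE]
  | single p c =>
    have h1 : BiDiffOp.res h (Finsupp.single p c) = Finsupp.single p (Sm.res h c) :=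
      Finsupp.mapRange_single (hf := map_zero _)
    rw [h1, BiDiffOp.single_apply, BiDiffOp.contract, Finsupp.sum_single_index (by simp)]
    split_ifs with hp
    · have h2 : DiffOp.res h (Finsupp.single (p.1 + p.2) c) =
          Finsupp.single (p.1 + p.2) (Sm.res h c) :=
        Finsupp.mapRange_single (hf := map_zero _)
      rw [h2, DiffOp.single_apply, partialD_add_mul ha hb hp.1 hp.2, mul_assoc]
    · rw [map_zero, DiffOp.zero_apply]
      rcases not_and_or.1 hp with hp | hp
      · rw [partialD_antihol_eq_zero hb hp, mul_zero, zero_mul]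
      · rw [partialD_hol_eq_zero ha hp, mul_zero]

theorem DiffOp.res_refl (D : DiffOp U) : DiffOp.res le_rfl D = D :=
  Finsupp.ext fun _ => rfl

theorem BiDiffOp.res_refl (B : BiDiffOp U) : BiDiffOp.res le_rfl B = B :=
  Finsupp.ext fun _ => rfl

theorem FormalDiffOp.res_refl (A : FormalDiffOp U) : A.res le_rfl = A := by
  ext1
  funext n
  exact DiffOp.res_refl _

theorem StarProduct.mulOn_refl (S : StarProduct U) (f g : FF U) :
    S.mulOn le_rfl f g = S.mul f g := by
  simp only [StarProduct.mulOn, StarProduct.mul, BiDiffOp.res_refl]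

/-- The defining property fixes the transform on all exponentials, and so determines all its
coefficients. -/
theorem IsBerezinTransform.apply_expFn {S : StarProduct U} {I : FormalDiffOp U}
    (hI : IsBerezinTransform S I) (ζ : Fin m ⊕ Fin m → ℂ) :
    I.apply (toFF (expFn ζ)) = S.mul (toFF (expFn (Sum.elim 0 (ζ ∘ Sum.inr))))
      (toFF (expFn (Sum.elim (ζ ∘ Sum.inl) 0))) := by
  have := hI.2.2 U le_rfl _ _ (isHol_expFn (ζ ∘ Sum.inl)) (isAntihol_expFn (ζ ∘ Sum.inr))
  rwa [I.res_refl, S.mulOn_refl, ← expFn_eq_mul] at this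

theorem IsBerezinTransform.unique {S : StarProduct U} {I I' : FormalDiffOp U}
    (hI : IsBerezinTransform S I) (hI' : IsBerezinTransform S I') : I = I' := by
  ext1
  funext n
  rw [← sub_eq_zero]
  refine DiffOp.eq_zero_of_expFn _ fun ζ => ?_
  rw [DiffOp.sub_apply, ← FormalDiffOp.apply_toFF_coeff, ← FormalDiffOp.apply_toFF_coeff,
    hI.apply_expFn, hI'.apply_expFn, sub_self]

theorem exists_isBerezinTransform (S : StarProduct U) : ∃ I, IsBerezinTransform S I := by
  let I : FormalDiffOp U := HahnSeries.ofSuppBddBelow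
    (fun n : ℤ => if n < 0 then 0 else (S.C n.toNat).contract)
    ⟨0, fun n hn => by
      by_contra hlt
      exact hn (if_pos (not_le.1 hlt))⟩
  have hneg : ∀ k < 0, I.coeff k = 0 := fun k hk => if_pos hk
  have hnat : ∀ n : ℕ, I.coeff n = (S.C n).contract := fun n => by
    have : I.coeff n = if (n : ℤ) < 0 then 0 else (S.C n).contract := rfl
    rw [this, if_neg (by omega)]
  refine ⟨I, hneg, ?_, fun V h a b ha hb => ?_⟩
  · rw [← sub_eq_zero]
    refine DiffOp.eq_zero_of_expFn _ fun ζ => ?_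
    rw [DiffOp.sub_apply, DiffOp.apply_single_zero_one, expFn_eq_mul, ← Nat.cast_zero, hnat,
      ← DiffOp.res_refl (S.C 0).contract, BiDiffOp.contract_res_apply le_rfl _
        (isHol_expFn (ζ ∘ Sum.inl)) (isAntihol_expFn (ζ ∘ Sum.inr)), BiDiffOp.res_refl, S.C_zero,
      sub_self]
  · ext1
    funext n
    rw [FormalDiffOp.apply_toFF_coeff]
    by_cases hn : n < 0
    · rw [StarProduct.mulOn, starMul_coeff_of_lt _ (a := 0) (b := 0)
        (fun i hi => toFF_coeff_of_lt hi) (fun i hi => toFF_coeff_of_lt hi) (by omega)]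
      have : (I.res h).coeff n = DiffOp.res h (I.coeff n) := rfl
      rw [this, hneg n hn, map_zero, DiffOp.zero_apply]
    · obtain ⟨j, rfl⟩ : ∃ j : ℕ, n = j := ⟨n.toNat, by omega⟩
      have : (I.res h).coeff j = DiffOp.res h (I.coeff j) := rfl
      rw [this, hnat, BiDiffOp.contract_res_apply h _ ha hb, StarProduct.mulOn,
        starMul_toFF_coeff]

theorem existsUnique_isBerezinTransform (S : StarProduct U) : ∃! I, IsBerezinTransform S I := by
  obtain ⟨I, hI⟩ := exists_isBerezinTransform S
  exact ⟨I, hI, fun I' hI' => hI'.unique hI⟩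

theorem IsBerezinTransform.bijective {S : StarProduct U} {I : FormalDiffOp U}
    (hI : IsBerezinTransform S I) : Function.Bijective I.apply :=
  FormalDiffOp.bijective hI.1 hI.2.1

/-! ### Formal integrals -/

/-- The formal functions with compact support. -/
def cptFF (U : Op m) : AddSubgroup (FF U) where
  carrier := {f | IsCpt f}
  zero_mem' _ := (cptSm U).zero_mem
  add_mem' hf hg n := (cptSm U).add_mem (hf n) (hg n)
  neg_mem' hf n := (cptSm U).neg_mem (hf n)

theorem IsCpt.mul_right {f : FF U} (hf : IsCpt f) (g : FF U) : IsCpt (f * g) := fun n => by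
  rw [HahnSeries.coeff_mul]
  exact (cptSm U).sum_mem fun p _ => cptSm_mul_right (hf p.1) _

theorem IsCpt.mul_left {f : FF U} (hf : IsCpt f) (g : FF U) : IsCpt (g * f) := by
  rw [mul_comm]
  exact hf.mul_right g

theorem IsCpt.star (S : StarProduct U) {f g : FF U} (h : IsCpt f ∨ IsCpt g) :
    IsCpt (S.mul f g) := fun n => by
  refine finsum_induction (· ∈ cptSm U) (cptSm U).zero_mem (fun _ _ => (cptSm U).add_mem)
    fun p => ?_
  exact BiDiffOp.apply_mem_cptSm _ (h.imp (fun h => h _) (fun h => h _))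

theorem isCpt_single (i : ℤ) {φ : Sm U} (hφ : φ ∈ cptSm U) : IsCpt (HahnSeries.single i φ) :=
  fun n => by
    rw [HahnSeries.coeff_single]
    split_ifs
    · exact hφ
    · exact (cptSm U).zero_mem

theorem fint_coeff (f : FF U) (n : ℤ) : (fint f).coeff n = integralHom U (f.coeff n) := rfl

theorem fint_add {f g : FF U} (hf : IsCpt f) (hg : IsCpt g) :
    fint (f + g) = fint f + fint g := by
  ext1
  funext n
  exact integralHom_add (hf n) (hg n)

theorem fint_zero : fint (0 : FF U) = 0 := by
  ext1
  funext n
  exact (integralHom U).map_zero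

theorem fint_neg (f : FF U) : fint (-f) = -fint f := by
  ext1
  funext n
  exact integralHom_neg _

theorem fint_sum {ι : Type*} (s : Finset ι) {f : ι → FF U} (hf : ∀ i ∈ s, IsCpt (f i)) :
    fint (∑ i ∈ s, f i) = ∑ i ∈ s, fint (f i) := by
  classical
  induction s using Finset.induction_on with
  | empty => simpa using fint_zero
  | insert i s hi ih =>
    rw [Finset.sum_insert hi, Finset.sum_insert hi, fint_add (hf i (Finset.mem_insert_self i s))
      ((cptFF U).sum_mem fun j hj => hf j (Finset.mem_insert_of_mem hj)),
      ih fun j hj => hf j (Finset.mem_insert_of_mem hj)]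

theorem fint_neg_one_pow_mul (k : ℕ) (f : FF U) : fint ((-1) ^ k * f) = (-1) ^ k * fint f := by
  rcases Nat.even_or_odd k with hk | hk
  · have h : (-1 : FF U) ^ k = 1 := Even.neg_one_pow (α := FF U) hk
    have h' : (-1 : LaurentSeries ℂ) ^ k = 1 := Even.neg_one_pow (α := LaurentSeries ℂ) hk
    rw [h, h', one_mul, one_mul]
  · have h : (-1 : FF U) ^ k = -1 := Odd.neg_one_pow (α := FF U) hk
    have h' : (-1 : LaurentSeries ℂ) ^ k = -1 := Odd.neg_one_pow (α := LaurentSeries ℂ) hk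
    have h1 : (-1 : FF U) * f = -f := neg_one_mul (α := FF U) f
    have h2 : (-1 : LaurentSeries ℂ) * fint f = -fint f := neg_one_mul (α := LaurentSeries ℂ) _
    rw [h, h', h1, h2, fint_neg]

/-- A `ν`-adically continuous additive functional that vanishes on monomials vanishes. -/
theorem eq_zero_of_single (p : AddSubgroup (Sm U)) (Λ : FF U → ℂ)
    (hadd : ∀ f g : FF U, (∀ n, f.coeff n ∈ p) → (∀ n, g.coeff n ∈ p) → Λ (f + g) = Λ f + Λ g)
    (hs : ∀ i, ∀ c ∈ p, Λ (HahnSeries.single i c) = 0)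
    (b : ℤ) (hb : ∀ f : FF U, (∀ i < b, f.coeff i = 0) → Λ f = 0)
    (f : FF U) (hf : ∀ n, f.coeff n ∈ p) : Λ f = 0 := by
  -- Induction on the number `k` of orders below `b` that may be nonzero: the lowest monomial is
  -- split off each time.
  have key : ∀ (k : ℕ) (f : FF U), (∀ n, f.coeff n ∈ p) → (∀ i < b - k, f.coeff i = 0) →
      Λ f = 0 := by
    intro k
    induction k with
    | zero => exact fun f _ h => hb f (by simpa using h)
    | succ k ih =>
      intro f hf h
      let c := f.coeff (b - (k + 1 : ℕ))
      let f' := f - HahnSeries.single (b - (k + 1 : ℕ)) c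
      have hsp : ∀ n, (HahnSeries.single (b - (k + 1 : ℕ)) c).coeff n ∈ p := fun n => by
        rw [HahnSeries.coeff_single]
        split_ifs
        · exact hf _
        · exact p.zero_mem
      have hf' : ∀ n, f'.coeff n ∈ p := fun n => p.sub_mem (hf n) (hsp n)
      have e : f = HahnSeries.single (b - (k + 1 : ℕ)) c + f' := by simp [f']
      rw [e, hadd _ _ hsp hf', hs _ _ (hf _), zero_add]
      refine ih f' hf' fun i hi => ?_
      change f.coeff i - (HahnSeries.single (b - (k + 1 : ℕ)) c).coeff i = 0
      by_cases hik : i = b - (k + 1 : ℕ)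
      · rw [hik, HahnSeries.coeff_single_same, sub_self]
      · rw [HahnSeries.coeff_single_of_ne hik, sub_zero]
        exact h i (by omega)
  obtain ⟨a, ha⟩ := exists_lower_bound f
  exact key (b - a).toNat f hf fun i hi => ha i (by omega)

/-! ### The trace identity for the Berezin transform -/

theorem toFF_mul (f g : Sm U) : toFF (f * g) = toFF f * toFF g :=
  map_mul HahnSeries.C f g

/-- Write the exponential as `b a`. Then `f ⋆ (b ⋆ a) = (f b) ⋆ a`, and the trace property replaces
this under the integral by `a ⋆ (f b) = a f b`. -/
theorem IsTraceDensity.fint_star_berezin_expFn {S : StarProduct U} (hS : S.HasSepVar) {t : FF U}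
    (ht : IsTraceDensity S t) {I : FormalDiffOp U} (hI : IsBerezinTransform S I) {f : FF U}
    (hf : IsCpt f) (ζ : Fin m ⊕ Fin m → ℂ) :
    fint (S.mul f (I.apply (toFF (expFn ζ))) * t) = fint (f * toFF (expFn ζ) * t) := by
  have h1 := fun f => (hS U le_rfl f).2 _ (isAntihol_expFn (ζ ∘ Sum.inr))
  have h2 := fun f => (hS U le_rfl f).1 _ (isHol_expFn (ζ ∘ Sum.inl))
  simp only [S.mulOn_refl] at h1 h2
  have h3 : ∀ f g h, S.mul f (S.mul g h) = S.mul (S.mul f g) h := fun f g h => (S.assoc f g h).symm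
  rw [hI.apply_expFn, h3, h1, ht _ _ (Or.inl (hf.mul_right _)), h2, expFn_eq_mul ζ, toFF_mul]
  congr 2
  ring

theorem isTransposable_mul (c : Sm U) : IsTransposable fun φ ψ => φ * ψ * c :=
  ⟨fun _ hφ _ => cptSm_mul_right (cptSm_mul_right hφ _) _, fun ψ => c * ψ,
    ⟨Finsupp.single 0 c, fun ψ => by rw [DiffOp.single_apply, partialD_zero]; rfl⟩,
    fun φ _ ψ => by congr 1; ring⟩

/-- A single coefficient involves only finitely many `C_r`, coefficients of `I` and coefficients of
`t`, and these do not depend on `φ` and `ψ`. -/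
theorem isTransposable_star_berezin (S : StarProduct U) {I : FormalDiffOp U}
    (hI : IsBerezinTransform S I) (t : FF U) (i n : ℤ) :
    IsTransposable fun φ ψ =>
      (S.mul (HahnSeries.single i φ) (I.apply (toFF ψ)) * t).coeff n := by
  obtain ⟨b, hb⟩ := exists_lower_bound t
  have hI0 : ∀ ψ, ∀ k < 0, (I.apply (toFF ψ)).coeff k = 0 := fun ψ k hk => by
    rw [I.apply_toFF_coeff, hI.1 k hk, DiffOp.zero_apply]
  have e : ∀ φ ψ, (S.mul (HahnSeries.single i φ) (I.apply (toFF ψ)) * t).coeff n =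
      ∑ l ∈ Finset.Icc i (n - b), ∑ r ∈ Finset.range (l - i + 1).toNat,
        (S.C r).apply φ ((I.coeff (l - i - r)).apply ψ) * t.coeff (n - l) := by
    intro φ ψ
    rw [laurent_mul_coeff (a := i) _ hb]
    · refine Finset.sum_congr rfl fun l _ => ?_
      rw [StarProduct.mul, starMul_single_left_coeff S.C i φ (hI0 ψ), Finset.sum_mul]
      simp only [I.apply_toFF_coeff]
    · intro k hk
      exact starMul_coeff_of_lt S.C (a := i) (b := 0)
        (fun j hj => HahnSeries.coeff_single_of_ne hj.ne) (hI0 ψ) (by omega)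
  simp only [e]
  exact IsTransposable.sum _ fun l _ => IsTransposable.sum _ fun r _ =>
    BiDiffOp.isTransposable _ (DiffOp.isDiff _) _

/-- The difference of the two transposed differential operators kills every exponential, because its
integrals against all test functions vanish; hence it is zero. -/
theorem IsTransposable.integralHom_eq {B B' : Sm U → Sm U → Sm U} (hB : IsTransposable B)
    (hB' : IsTransposable B') (h : ∀ φ ∈ cptSm U, ∀ ζ,
      integralHom U (B φ (expFn ζ)) = integralHom U (B' φ (expFn ζ)))
    {φ : Sm U} (hφ : φ ∈ cptSm U) (ψ : Sm U) :
    integralHom U (B φ ψ) = integralHom U (B' φ ψ) := by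
  obtain ⟨-, P, hP, hBP⟩ := hB
  obtain ⟨-, P', hP', hBP'⟩ := hB'
  have key : ∀ φ ∈ cptSm U, ∀ ψ, integralHom U (φ * (P ψ + (-1 : ℂ) • P' ψ)) =
      integralHom U (B φ ψ) - integralHom U (B' φ ψ) := by
    intro φ hφ ψ
    rw [mul_add, mul_smul_comm, integralHom_add (cptSm_mul_right hφ _)
      (cptSm_smul _ (cptSm_mul_right hφ _)), integralHom_smul, hBP φ hφ, hBP' φ hφ]
    ring
  have h0 : P ψ + (-1 : ℂ) • P' ψ = 0 :=
    IsDiff.eq_zero_of_expFn (hP.add (hP'.smul (-1)))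
      (fun ζ => eq_zero_of_integralHom_mul fun φ hφ => by
        rw [key φ hφ, h φ hφ, sub_self]) ψ
  rw [← sub_eq_zero, ← key φ hφ, h0, mul_zero, map_zero]

/-- For a trace density `t dz dz̄`, the integral of `f ⋆ I(h)` is the integral of `f h`. -/
theorem IsTraceDensity.fint_star_berezin {S : StarProduct U} (hS : S.HasSepVar) {t : FF U}
    (ht : IsTraceDensity S t) {I : FormalDiffOp U} (hI : IsBerezinTransform S I) {f : FF U}
    (hf : IsCpt f) (h : FF U) :
    fint (S.mul f (I.apply h) * t) = fint (f * h * t) := by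
  have hadd₁ : ∀ f f' g : FF U, S.mul (f + f') g = S.mul f g + S.mul f' g :=
    starMul_add_left S.C
  have hadd₂ : ∀ f g g' : FF U, S.mul f (g + g') = S.mul f g + S.mul f g' :=
    starMul_add_right S.C
  obtain ⟨c, hc⟩ := exists_lower_bound t
  -- First `h` is a single smooth function; continuity in `f` then leaves only monomial `f`.
  have smooth : ∀ f : FF U, IsCpt f → ∀ ψ : Sm U,
      fint (S.mul f (I.apply (toFF ψ)) * t) = fint (f * toFF ψ * t) := by
    intro f hf ψ
    ext1
    funext n
    rw [← sub_eq_zero]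
    obtain ⟨a, ha⟩ := exists_lower_bound (I.apply (toFF ψ))
    obtain ⟨a', ha'⟩ := exists_lower_bound (toFF ψ)
    -- If `f` starts at this order, then both products, multiplied by `t`, start beyond order `n`.
    refine eq_zero_of_single (cptSm U) (fun f => (fint (S.mul f (I.apply (toFF ψ)) * t)).coeff n -
      (fint (f * toFF ψ * t)).coeff n) ?_ ?_ (n - c - min a a' + 1) ?_ f hf
    · intro f g hf hg
      simp only [hadd₁, add_mul]
      rw [fint_add ((IsCpt.star S (Or.inl hf)).mul_right t) ((IsCpt.star S (Or.inl hg)).mul_right t),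
        fint_add (IsCpt.mul_right (IsCpt.mul_right hf _) t)
          (IsCpt.mul_right (IsCpt.mul_right hg _) t), HahnSeries.coeff_add, HahnSeries.coeff_add]
      ring
    · intro i φ hφ
      have e : ∀ φ ψ : Sm U, (HahnSeries.single i φ * toFF ψ * t).coeff n =
          φ * ψ * t.coeff (n - i) := by
        intro φ ψ
        rw [toFF, HahnSeries.C_apply, HahnSeries.single_mul_single, HahnSeries.coeff_single_mul,
          add_zero]
      simp only [fint_coeff, e]
      rw [sub_eq_zero]
      refine IsTransposable.integralHom_eq (isTransposable_star_berezin S hI t i n)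
        (isTransposable_mul (t.coeff (n - i))) (fun φ hφ ζ => ?_) hφ ψ
      have := congrArg (fun x => x.coeff n)
        (ht.fint_star_berezin_expFn hS hI (isCpt_single i hφ) ζ)
      simpa only [fint_coeff, e] using this
    · intro f hf
      simp only [fint_coeff, StarProduct.mul]
      rw [laurent_mul_coeff_of_lt (a := n - c - min a a' + 1 + a)
          (fun k hk => starMul_coeff_of_lt S.C hf ha hk) hc (by omega),
        laurent_mul_coeff_of_lt (a := n - c - min a a' + 1 + a')
          (fun k hk => laurent_mul_coeff_of_lt hf ha' hk) hc (by omega), sub_self]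
  ext1
  funext n
  rw [← sub_eq_zero]
  obtain ⟨a, ha⟩ := exists_lower_bound f
  -- Now the continuity argument runs in `h`. Its coefficients are unrestricted, since compact
  -- support of `f` makes all integrals converge.
  refine eq_zero_of_single ⊤ (fun h => (fint (S.mul f (I.apply h) * t)).coeff n -
      (fint (f * h * t)).coeff n) ?_ ?_ (n - c - a + 1) ?_ h (fun _ => trivial)
  · intro h h' _ _
    simp only [I.apply_add, hadd₂, add_mul, mul_add]
    rw [fint_add ((IsCpt.star S (Or.inl hf)).mul_right t) ((IsCpt.star S (Or.inl hf)).mul_right t),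
      fint_add ((hf.mul_right _).mul_right t) ((hf.mul_right _).mul_right t),
      HahnSeries.coeff_add, HahnSeries.coeff_add]
    ring
  · intro j ψ _
    have e : (HahnSeries.single j ψ : FF U) = HahnSeries.single j 1 * toFF ψ := by
      rw [toFF, HahnSeries.C_apply, HahnSeries.single_mul_single, add_zero, one_mul]
    -- The power of `ν` is transferred from `h` to `f`, which reduces the monomial to the smooth
    -- case.
    rw [I.apply_single, StarProduct.mul, starMul_single_one_mul, e, ← mul_assoc f,
      mul_comm f, ← smooth _ (hf.mul_left _), StarProduct.mul, sub_self]
  · intro h hh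
    simp only [fint_coeff, StarProduct.mul]
    rw [laurent_mul_coeff_of_lt (a := a + (n - c - a + 1)) (fun k hk => starMul_coeff_of_lt S.C ha
        (fun i hi => FormalDiffOp.apply_coeff_of_lt hI.1 hh hi) hk) hc (by omega),
      laurent_mul_coeff_of_lt (a := a + (n - c - a + 1))
        (fun k hk => laurent_mul_coeff_of_lt ha hh hk) hc (by omega), sub_self]

/-! ### Matrices over the star algebra -/

/-- The algebra of formal functions with the star product. -/
def StarAlg (_S : StarProduct U) : Type := FF U

instance (S : StarProduct U) : AddCommGroup (StarAlg S) := inferInstanceAs (AddCommGroup (FF U))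

instance (S : StarProduct U) : Ring (StarAlg S) :=
  { (inferInstance : AddCommGroup (StarAlg S)) with
    mul := S.mul
    one := (1 : FF U)
    left_distrib := fun f g h => starMul_add_right S.C f g h
    right_distrib := fun f g h => starMul_add_left S.C f g h
    zero_mul := fun f => starMul_zero_left S.C f
    mul_zero := fun f => starMul_zero_right S.C f
    mul_assoc := S.assoc
    one_mul := S.one_mul
    mul_one := S.mul_one }

/-- A matrix of formal functions, viewed as a matrix over the star algebra. -/
def toMatrix (S : StarProduct U) (F : Mat d U) :
    Matrix (Finset (Fin d)) (Finset (Fin d)) (StarAlg S) := F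

theorem toMatrix_matOne (S : StarProduct U) : toMatrix S (matOne (d := d)) = 1 := by
  ext K I
  rw [Matrix.one_apply]
  rfl

theorem matMul_assoc (S : StarProduct U) (F G H : Mat d U) :
    matMul S (matMul S F G) H = matMul S F (matMul S G H) :=
  mul_assoc (toMatrix S F) (toMatrix S G) (toMatrix S H)

theorem matMul_one (S : StarProduct U) (F : Mat d U) : matMul S F matOne = F := by
  change toMatrix S F * toMatrix S matOne = toMatrix S F
  rw [toMatrix_matOne, mul_one]

theorem one_matMul (S : StarProduct U) (F : Mat d U) : matMul S matOne F = F := by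
  change toMatrix S matOne * toMatrix S F = toMatrix S F
  rw [toMatrix_matOne, one_mul]

theorem StarProduct.zero_mul (S : StarProduct U) (f : FF U) : S.mul 0 f = 0 :=
  starMul_zero_left S.C f

theorem StarProduct.mul_zero (S : StarProduct U) (f : FF U) : S.mul f 0 = 0 :=
  starMul_zero_right S.C f

theorem matMul_isCpt_left (S : StarProduct U) {F : Mat d U} (hF : SF.IsCpt F) (G : Mat d U) :
    SF.IsCpt (matMul S F G) := fun _ _ =>
  (cptFF U).sum_mem fun _ _ => IsCpt.star S (Or.inl (hF _ _))

theorem matMul_isCpt_right (S : StarProduct U) (F : Mat d U) {G : Mat d U} (hG : SF.IsCpt G) :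
    SF.IsCpt (matMul S F G) := fun _ _ =>
  (cptFF U).sum_mem fun _ _ => IsCpt.star S (Or.inr (hG _ _))

theorem SF.IsCpt.mul_left {f : SF d U} (hf : f.IsCpt) (g : SF d U) : SF.IsCpt (g * f) :=
  fun _ _ => (cptFF U).sum_mem fun _ _ => (cptFF U).sum_mem fun _ _ => (hf _ _).mul_left _

/-- The parity of an entry is `|K| + |J|`, and the intermediate `|I|` is counted twice. -/
theorem isHomogeneous_matMul (S : StarProduct U) {ε η : ZMod 2} {F G : Mat d U}
    (hF : Grass.IsHomogeneous ε F) (hG : Grass.IsHomogeneous η G) :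
    Grass.IsHomogeneous (ε + η) (matMul S F G) := by
  intro K J hKJ
  refine Finset.sum_eq_zero fun I _ => ?_
  by_cases h1 : ((K.card + I.card : ℕ) : ZMod 2) = ε
  · rw [hG I J, S.mul_zero]
    rintro h2
    refine hKJ ?_
    rw [← h1, ← h2]
    push_cast
    have : (I.card : ZMod 2) + I.card = 0 := CharTwo.add_self_eq_zero _
    linear_combination -this
  · rw [hF _ _ h1, S.zero_mul]

/-- The star inverse of an even matrix is even. -/
theorem IsStarInverse.even {S : StarProduct U} {u : SF d U} (hu : Grass.IsHomogeneous 0 u)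
    {v : Mat d U} (hv : IsStarInverse S u v) : Grass.IsHomogeneous 0 v := by
  classical
  -- The even part of `v` is also a right inverse: the even entries of `u ⋆ v = 1` involve only it,
  -- and the odd entries vanish. It then equals `v` by uniqueness of inverses.
  let w : Mat d U := fun K L => if ((K.card + L.card : ℕ) : ZMod 2) = 0 then v K L else 0
  have huw : matMul S (coeffMat u) w = matOne := by
    funext P R
    by_cases hPR : ((P.card + R.card : ℕ) : ZMod 2) = 0
    · rw [← hv.1]
      refine Finset.sum_congr rfl fun Q _ => ?_
      by_cases hPQ : ((P.card + Q.card : ℕ) : ZMod 2) = 0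
      · have hQR : ((Q.card + R.card : ℕ) : ZMod 2) = 0 := by
          push_cast at hPR hPQ ⊢
          have : (P.card : ZMod 2) + P.card = 0 := CharTwo.add_self_eq_zero _
          linear_combination hPR + hPQ - this
        simp only [w, if_pos hQR]
      · rw [show coeffMat u P Q = 0 from hu _ _ hPQ, S.zero_mul, S.zero_mul]
    · have hw : Grass.IsHomogeneous 0 w := fun K L h => if_neg h
      have h0 := isHomogeneous_matMul S (F := coeffMat u) hu hw P R (by rwa [add_zero])
      rw [h0, matOne, if_neg]
      rintro rfl
      refine hPR ?_
      push_cast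
      exact CharTwo.add_self_eq_zero _
  have : v = w := by
    rw [← matMul_one S v, ← huw, ← matMul_assoc, hv.2, one_matMul]
  rw [this]
  exact fun K L h => if_neg h

/-! ### The product associated with `(⋆, u)` -/

section Admissible

variable {S : StarProduct U} {u : SF d U} {v : Mat d U}

/-- A matrix of formal functions, viewed as the function with these coefficients. -/
def ofCoeffMat (F : Mat d U) : SF d U := F

theorem coeffMat_ofCoeffMat (F : Mat d U) : coeffMat (ofCoeffMat F) = F := rfl

theorem ofCoeffMat_coeffMat (f : SF d U) : ofCoeffMat (coeffMat f) = f := rfl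

theorem mop_eq (S : StarProduct U) (u : SF d U) (F : Mat d U) :
    mop S u F = Ring.inverse u * ofCoeffMat (matMul S F (coeffMat u)) := rfl

/-- Solve `u⁻¹ (F ⋆ u) = f` for `F`: multiply by `u` pointwise, then by `v` on the right.
`Ring.inverse` is a genuine inverse here because the body of `u` is 1. -/
theorem mop_matMul_inverse (hu : IsAdmissible S u) (hv : IsStarInverse S u v) (f : SF d U) :
    mop S u (matMul S (coeffMat (u * f)) v) = f := by
  rw [mop_eq, matMul_assoc, hv.2, matMul_one, ofCoeffMat_coeffMat, ← mul_assoc,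
    Ring.inverse_mul_cancel u (Grass.isUnit_of_body hu.body), one_mul]

theorem mop_bijective (hu : IsAdmissible S u) : Function.Bijective (mop S u) := by
  obtain ⟨v, hv⟩ := hu.inverse
  have left : ∀ F : Mat d U, matMul S (coeffMat (u * mop S u F)) v = F := fun F => by
    rw [mop_eq, ← mul_assoc, Ring.mul_inverse_cancel u (Grass.isUnit_of_body hu.body), one_mul,
      coeffMat_ofCoeffMat, matMul_assoc, hv.1, matMul_one]
  exact ⟨fun F G h => by rw [← left F, h, left G], fun f => ⟨_, mop_matMul_inverse hu hv f⟩⟩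

theorem symbolMat_mop (hu : IsAdmissible S u) (F : Mat d U) : symbolMat S u (mop S u F) = F :=
  Function.leftInverse_invFun (mop_bijective hu).1 F

/-- This explicit symbol is the source of the supports, the parities and the density formula below.
-/
theorem symbolMat_eq (hu : IsAdmissible S u) (hv : IsStarInverse S u v) (f : SF d U) :
    symbolMat S u f = matMul S (coeffMat (u * f)) v := by
  rw [← symbolMat_mop hu (matMul S (coeffMat (u * f)) v), mop_matMul_inverse hu hv]

theorem symbolMat_isCpt (hu : IsAdmissible S u) {f : SF d U} (hf : f.IsCpt) :
    SF.IsCpt (symbolMat S u f) := by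
  obtain ⟨v, hv⟩ := hu.inverse
  rw [symbolMat_eq hu hv]
  exact matMul_isCpt_left S (hf.mul_left u) v

theorem isHomogeneous_symbolMat (hu : IsAdmissible S u) {ε : ZMod 2} {f : SF d U}
    (hf : Grass.IsHomogeneous ε f) : Grass.IsHomogeneous ε (symbolMat S u f) := by
  obtain ⟨v, hv⟩ := hu.inverse
  rw [symbolMat_eq hu hv]
  have h := isHomogeneous_matMul S (F := coeffMat (u * f)) (hu.even.mul hf) (hv.even hu.even)
  rwa [add_zero, zero_add] at h

theorem superMul_isCpt (hu : IsAdmissible S u) {f g : SF d U} (h : f.IsCpt ∨ g.IsCpt) :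
    SF.IsCpt (superMul S u f g) := by
  rw [superMul, mop_eq]
  refine SF.IsCpt.mul_left (matMul_isCpt_left S ?_ _) _
  rcases h with h | h
  · exact matMul_isCpt_left S (symbolMat_isCpt hu h) _
  · exact matMul_isCpt_right S _ (symbolMat_isCpt hu h)

/-! ### The supertrace and its density -/

theorem SF.mul_mulRight (f g : SF d U) (t : FF U) : f * g.mulRight t = (f * g).mulRight t := by
  funext K L
  simp only [SF.mulRight, Grass.mul_apply, Finset.sum_mul, mul_assoc]

/-- The supertrace of a product of matrices, one of which has compact support. -/
theorem Str_matMul {t : FF U} {F G : Mat d U} (h : SF.IsCpt F ∨ SF.IsCpt G) :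
    Str t (matMul S F G) = ∑ K, ∑ I, (-1) ^ K.card * fint (S.mul (F K I) (G I K) * t) := by
  refine Finset.sum_congr rfl fun K _ => ?_
  rw [matMul, Finset.sum_mul, fint_sum, Finset.mul_sum]
  exact fun I _ => (IsCpt.star S (h.imp (fun h => h K I) (fun h => h I K))).mul_right t

/-- Interchanging two entries by the trace property changes the sign from `(-1)^|K|` to `(-1)^|I|`.
A nonzero term forces `|K| + |I|` to have parity both `ε` and `η`, and then `ε η` has that parity
too. -/
theorem Str_matMul_comm {t : FF U} (ht : IsTraceDensity S t) {ε η : ZMod 2} {F G : Mat d U}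
    (hF : Grass.IsHomogeneous ε F) (hG : Grass.IsHomogeneous η G)
    (h : SF.IsCpt F ∨ SF.IsCpt G) :
    Str t (matMul S F G) = (-1) ^ (ε.val * η.val) * Str t (matMul S G F) := by
  rw [Str_matMul h, Str_matMul h.symm, Finset.sum_comm, Finset.mul_sum]
  refine Finset.sum_congr rfl fun I _ => ?_
  rw [Finset.mul_sum]
  refine Finset.sum_congr rfl fun K _ => ?_
  by_cases h1 : ((K.card + I.card : ℕ) : ZMod 2) = ε
  · by_cases h2 : ((I.card + K.card : ℕ) : ZMod 2) = η
    · rw [ht _ _ (h.imp (fun h => h K I) (fun h => h I K)), ← mul_assoc, ← pow_add]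
      congr 1
      refine neg_one_pow_eq_of_even_add ?_
      rw [add_comm] at h2
      rw [← h2, h1, ← ZMod.natCast_eq_zero_iff_even]
      push_cast
      rw [ZMod.natCast_val, ZMod.cast_id]
      push_cast at h1
      -- Here `η = ε`, so the exponent `ε η` is `ε²`, which equals `ε` modulo 2.
      have : ∀ x : ZMod 2, x + x * x = 0 := by decide
      linear_combination h1 + this ε
    · rw [hG _ _ h2, S.mul_zero, S.zero_mul, MulZeroClass.zero_mul, fint_zero]
      simp
  · rw [hF _ _ h1, S.mul_zero, S.zero_mul, MulZeroClass.zero_mul, fint_zero]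
    simp

/-- The density `u τ t` represents the canonical supertrace. -/
theorem representsSupertrace_tauFn (hS : S.HasSepVar) (hu : IsAdmissible S u) {t : FF U}
    (ht : IsTraceDensity S t) (hv : IsStarInverse S u v) {I : FormalDiffOp U}
    (hI : IsBerezinTransform S I) :
    RepresentsSupertrace S u t ((u * tauFn I v).mulRight t) := by
  intro f hf
  have hg : SF.IsCpt (u * f) := hf.mul_left u
  have hinv : ∀ h : FF U, I.apply (Function.invFun I.apply h) = h :=
    Function.rightInverse_invFun hI.bijective.2
  rw [canonicalSupertrace, symbolMat_eq hu hv, Str_matMul (F := coeffMat (u * f)) (Or.inl hg), berezinInt,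
    SF.mul_mulRight, ← mul_assoc, Grass.mul_comm_of_even hu.even, SF.mulRight,
    Grass.mul_apply_univ, Finset.sum_mul, fint_sum]
  · refine Finset.sum_congr rfl fun K _ => ?_
    rw [Finset.sum_mul, fint_sum]
    · refine Finset.sum_congr rfl fun L _ => ?_
      rw [show coeffMat (u * f) K L = (u * f) K L from rfl]
      -- Writing `v^{LK}` as `I(I⁻¹ v^{LK})` makes the trace identity applicable.
      rw [← fint_neg_one_pow_mul, ← hinv (v L K)]
      rw [fint_neg_one_pow_mul, ht.fint_star_berezin hS hI (hg K L), ← fint_neg_one_pow_mul]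
      congr 1
      rw [tauFn, compl_compl, compl_compl]
      -- The Berezin integral and `τ` at the complementary index both carry `(-1)^λ(K,L)`; these
      -- cancel and leave the supertrace sign `(-1)^|K|`.
      have h1 : ((-1 : FF U)) ^ lamExp K L * (-1) ^ lamExp K L = 1 :=
        neg_one_pow_mul_self _
      rw [pow_add]
      linear_combination (-(-1) ^ K.card * (u * f) K L * Function.invFun I.apply (v L K) * t) * h1
    · exact fun L _ => ((hg K L).mul_left _).mul_right _ |>.mul_right _
  · intro K _
    rw [Finset.sum_mul]
    exact (cptFF U).sum_mem fun L _ => ((hg K L).mul_left _).mul_right _ |>.mul_right _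

/-! ### Uniqueness of the density and the supertrace property -/

theorem eq_of_integralHom_mul {a b : Sm U}
    (h : ∀ φ ∈ cptSm U, integralHom U (φ * a) = integralHom U (φ * b)) : a = b := by
  have h0 : a + (-1 : ℂ) • b = 0 := eq_zero_of_integralHom_mul fun φ hφ => by
    rw [mul_add, mul_smul_comm, integralHom_add (cptSm_mul_right hφ _)
      (cptSm_smul _ (cptSm_mul_right hφ _)), integralHom_smul, h φ hφ]
    ring
  rw [neg_one_smul] at h0
  exact add_neg_eq_zero.1 h0

/-- The Berezin pairing is perfect: a test function `φ θ^K θ̄^L` with `K, L` the complements of `I,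
J` isolates the coefficient `ρ I J` up to sign. -/
theorem eq_of_berezinInt_mul {ρ ρ' : SF d U}
    (h : ∀ f : SF d U, f.IsCpt → berezinInt (f * ρ) = berezinInt (f * ρ')) : ρ = ρ' := by
  classical
  funext I J
  ext1
  funext n
  refine eq_of_integralHom_mul fun φ hφ => ?_
  let f : SF d U := fun K L => if K = Iᶜ ∧ L = Jᶜ then toFF φ else 0
  have hf : f.IsCpt := fun K L => by
    simp only [f]
    split_ifs
    · exact isCpt_single 0 hφ
    · exact (cptFF U).zero_mem
  have key : ∀ ρ : SF d U, berezinInt (f * ρ) =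
      (-1) ^ lamExp Iᶜ Jᶜ * fint (toFF φ * ρ I J) := by
    intro ρ
    rw [berezinInt, Grass.mul_apply_univ, Finset.sum_eq_single Iᶜ, Finset.sum_eq_single Jᶜ]
    · rw [compl_compl, compl_compl, ← fint_neg_one_pow_mul, ← mul_assoc,
        show f Iᶜ Jᶜ = toFF φ from if_pos ⟨rfl, rfl⟩]
    · intro L _ hL
      rw [show f Iᶜ L = 0 from if_neg fun h => hL h.2]
      ring
    · exact fun h => absurd (Finset.mem_univ _) h
    · intro K _ hK
      refine Finset.sum_eq_zero fun L _ => ?_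
      rw [show f K L = 0 from if_neg fun h => hK h.1]
      ring
    · exact fun h => absurd (Finset.mem_univ _) h
  have h1 := h f hf
  rw [key, key] at h1
  have h2 : fint (toFF φ * ρ I J) = fint (toFF φ * ρ' I J) :=
    mul_left_cancel₀ (pow_ne_zero _ (neg_ne_zero.2 (one_ne_zero (α := LaurentSeries ℂ)))) h1
  have h3 := congrArg (fun x => x.coeff n) h2
  simpa only [fint_coeff, toFF, HahnSeries.C_apply, HahnSeries.coeff_single_mul, sub_zero] using h3

/-- Symbols turn `∗` into the matrix product and preserve parity and compact support, so the graded
symmetry of `Str` transfers. -/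
theorem RepresentsSupertrace.isSupertraceDensity (hu : IsAdmissible S u) {t : FF U}
    (ht : IsTraceDensity S t) {ρ : SF d U} (hρ : RepresentsSupertrace S u t ρ) :
    IsSupertraceDensity S u ρ := by
  intro ε η f g hf hg h
  rw [← hρ _ (superMul_isCpt hu h), ← hρ _ (superMul_isCpt hu h.symm), canonicalSupertrace,
    canonicalSupertrace, superMul, superMul, symbolMat_mop hu, symbolMat_mop hu]
  exact Str_matMul_comm ht (isHomogeneous_symbolMat hu hf) (isHomogeneous_symbolMat hu hg)
    (h.imp (symbolMat_isCpt hu) (symbolMat_isCpt hu))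

end Admissible

end

end SuperBerezin

/-! ### The main theorem -/

open SuperBerezin
theorem theoremT (m d : ℕ) (U : Op m) (S : StarProduct U) (hsep : S.HasSepVar)
    (hnd : S.IsNondegenerate) (u : SF d U) (hu : IsAdmissible S u)
    (t : FF U) (ht : IsCanonicalTraceDensity S t) :
    Function.Bijective (mop S u) ∧
    (∃! ρ : SF d U, RepresentsSupertrace S u t ρ) ∧
    (∃! I : FormalDiffOp U, IsBerezinTransform S I) ∧
    ∀ ρ : SF d U, RepresentsSupertrace S u t ρ →
      IsSupertraceDensity S u ρ ∧
      ∀ (v : Mat d U) (I : FormalDiffOp U), IsStarInverse S u v → IsBerezinTransform S I →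
        Function.Bijective I.apply ∧ ρ = (u * tauFn I v).mulRight t := by
  -- With uniqueness, any representing density must be the explicit `u τ t`, which also supplies
  -- existence.
  have unique : ∀ ρ ρ' : SF d U, RepresentsSupertrace S u t ρ → RepresentsSupertrace S u t ρ' →
      ρ = ρ' := fun ρ ρ' h h' =>
    eq_of_berezinInt_mul fun f hf => by rw [← h f hf, ← h' f hf]
  have rep := fun {v I} => representsSupertrace_tauFn (v := v) (I := I) hsep hu ht.trace
  refine ⟨mop_bijective hu, ?_, existsUnique_isBerezinTransform S, fun ρ hρ =>
    ⟨hρ.isSupertraceDensity hu ht.trace, fun v I hv hI =>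
      ⟨hI.bijective, unique _ _ hρ (rep hv hI)⟩⟩⟩
  obtain ⟨v, hv⟩ := hu.inverse
  obtain ⟨I, hI⟩ := exists_isBerezinTransform S
  exact ⟨_, rep hv hI, fun ρ hρ => unique _ _ hρ (rep hv hI)⟩
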